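/- Let $\Omega\subset\mathbb R^2$ be a closed strictly convex domain (compact, with the origin in its interior) whose boundary $\gamma=\partial\Omega$ is a regular simple closed curve of class $C^2$. Assume that $\gamma$ is a centrally symmetric Radon curve: $\gamma=-\gamma$, and for all $x,y\in\gamma$, if $y$ is parallel to the tangent line to $\gamma$ at $x$, then $x$ is parallel to the tangent line to $\gamma$ at $y$. For a closed strictly convex domain $K$ with $C^2$ boundary and with the origin in its interior, the outer billiard about $K$ has the following generating function in polar angles: for $\varphi_1<\varphi_2<\varphi_1+\pi$, $\mathcal S^{\rm out}_K(\varphi_1,\varphi_2)$ is the area of the triangle bounded by the rays from the origin with angles $\varphi_1,\varphi_2$ and by the segment with ends on these rays that is tangent to $\partial K$ exactly at its midpoint. A configuration $(\varphi_i)_{i\in\mathbb Z}$ with $\varphi_i<\varphi_{i+1}<\varphi_i+\pi$ for all $i$ is action-minimizing if each of its finite segments minimizes $\sum_i\mathcal S^{\rm out}_K(\varphi_i,\varphi_{i+1})$ among all finite sequences of the same length that have the same ends and satisfy the same inequalities; it has rotation number $\omega$ if $\varphi_i/(2\pi i)\to\omega$ as $i\to\pm\infty$. Mather's $\beta$-function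 is $$\beta^{\rm out}_K(\omega)=\lim_{N\to\infty}\frac1{2N}\sum_{i=-N}^{N-1}\mathcal S^{\rm out}_K(\varphi_i,\varphi_{i+1})$$ for any action-minimizing configuration $(\varphi_i)$ of rotation number $\omega$. Let $\mathcal D$ be the unit disk centred at the origin and let $|\Omega|$ be the area of $\Omega$. Then $\beta^{\rm out}_\Omega(1/4)$ and $\beta^{\rm out}_{\mathcal D}(1/4)$ are well defined (action-minimizing configurations of rotation number $1/4$ exist, and for all of them the limit exists and has the same value), and $$\beta^{\rm out}_\Omega\Big(\frac14\Big)\;\ge\;\frac{|\Omega|}{\pi}\,\beta^{\rm out}_{\mathcal D}\Big(\frac14\Big),$$ with equality if and only if $\Omega$ is an ellipse. -/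

import Mathlib

open MeasureTheory Filter Topology

noncomputable section

namespace OuterBilliard

/-- The Euclidean plane. -/
abbrev Plane : Type := EuclideanSpace ℝ (Fin 2)

/-! ### Convex tables, tangents, Radon curves -/

/-- `γ` is a regular `C²` parametrization, of period one, of the simple closed curve `Γ`. -/
structure IsC2Param (Γ : Set Plane) (γ : ℝ → Plane) : Prop where
  contDiff : ContDiff ℝ 2 γ
  periodic : Function.Periodic γ 1
  injOn : Set.InjOn γ (Set.Ico 0 1)
  regular : ∀ t, deriv γ t ≠ 0
  range_eq : Set.range γ = Γ

/-- The nonzero vector `v` is parallel to the tangent line at the point `x` to the `C²` regular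
simple closed curve `Γ`. In particular `x ∈ Γ`. (The tangent line does not depend on the
parametrization.) -/
def IsTangentVector (Γ : Set Plane) (x v : Plane) : Prop :=
  v ≠ 0 ∧ ∃ γ : ℝ → Plane, IsC2Param Γ γ ∧ ∃ t c : ℝ, γ t = x ∧ v = c • deriv γ t

/-- A (closed) strictly convex planar domain with `C²` boundary and with the origin inside. -/
structure IsTable (Ω : Set Plane) : Prop where
  isCompact : IsCompact Ω
  strictConvex : StrictConvex ℝ Ω
  zero_mem : (0 : Plane) ∈ interior Ω
  boundary : ∃ γ : ℝ → Plane, IsC2Param (frontier Ω) γ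

/-- For points `x, y` of `Γ`: the vector `y` is Birkhoff orthogonal to `x`, that is, `y` is
parallel to the tangent line to `Γ` at `x`. -/
def BirkhoffOrthogonal (Γ : Set Plane) (x y : Plane) : Prop :=
  IsTangentVector Γ x y

/-- A Radon curve: symmetric with respect to the origin, with symmetric Birkhoff
orthogonality. -/
structure IsRadonCurve (Γ : Set Plane) : Prop where
  neg_mem : ∀ x ∈ Γ, -x ∈ Γ
  symm : ∀ x ∈ Γ, ∀ y ∈ Γ, BirkhoffOrthogonal Γ x y → BirkhoffOrthogonal Γ y x

/-- The closed unit disk centred at the origin. -/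
def unitDisk : Set Plane := Metric.closedBall 0 1

/-- A (filled) ellipse: the image of the unit disk under an affine bijection of the plane. -/
def IsEllipse (Ω : Set Plane) : Prop :=
  ∃ A : Plane ≃ᵃ[ℝ] Plane, Ω = A '' unitDisk

/-! ### The generating function of the outer billiard in polar coordinates -/

/-- The unit vector of polar angle `φ`. -/
def dir (φ : ℝ) : Plane := !₂[Real.cos φ, Real.sin φ]

/-- The segment from `a • dir φ₁` to `b • dir φ₂`, with ends on the two rays, is tangent to the
boundary of `Ω` exactly at its midpoint. -/
def IsMidpointTangentSegment (Ω : Set Plane) (φ₁ φ₂ a b : ℝ) : Prop :=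
  0 < a ∧ 0 < b ∧
    IsTangentVector (frontier Ω) (midpoint ℝ (a • dir φ₁) (b • dir φ₂))
      (b • dir φ₂ - a • dir φ₁)

/-- The generating function, meant for `φ₁ < φ₂ < φ₁ + π`: the area `a b sin (φ₂ - φ₁) / 2` of
the triangle bounded by the rays of angles `φ₁`, `φ₂` and by the segment with ends on these rays
that is tangent to the boundary of `Ω` at its midpoint (there is exactly one such segment). -/
def generatingFunction (Ω : Set Plane) (φ₁ φ₂ : ℝ) : ℝ :=
  Classical.epsilon fun σ : ℝ =>
    ∃ a b : ℝ, IsMidpointTangentSegment Ω φ₁ φ₂ a b ∧ σ = a * b * Real.sin (φ₂ - φ₁) / 2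

/-! ### Minimal orbits and Mather's beta function

Configurations are bi-infinite sequences of (lifted) polar angles; one turn is `2π`, and the
generating function lives on `{(φ₁, φ₂) | φ₁ < φ₂ < φ₁ + π}`. -/

/-- The pair `(φ₁, φ₂)` is in the domain of the generating function. -/
def Admissible (φ₁ φ₂ : ℝ) : Prop := φ₁ < φ₂ ∧ φ₂ < φ₁ + Real.pi

/-- The action of the segment `x m, …, x n`. -/
def segmentAction (S : ℝ → ℝ → ℝ) (x : ℤ → ℝ) (m n : ℤ) : ℝ :=
  ∑ i ∈ Finset.Ico m n, S (x i) (x (i + 1))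

/-- An action-minimizing configuration: each finite segment minimizes the action among the
admissible segments with the same ends. -/
structure IsMinimalConfiguration (S : ℝ → ℝ → ℝ) (x : ℤ → ℝ) : Prop where
  admissible : ∀ i, Admissible (x i) (x (i + 1))
  minimal : ∀ m n : ℤ, m < n → ∀ y : ℤ → ℝ,
    (∀ i ∈ Finset.Ico m n, Admissible (y i) (y (i + 1))) → y m = x m → y n = x n →
      segmentAction S x m n ≤ segmentAction S y m n

/-- The configuration `x` has rotation number `ω` (in turns per step). -/
def HasRotationNumber (x : ℤ → ℝ) (ω : ℝ) : Prop :=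
  Tendsto (fun i : ℤ => x i / (2 * Real.pi * (i : ℝ))) atTop (𝓝 ω) ∧
    Tendsto (fun i : ℤ => x i / (2 * Real.pi * (i : ℝ))) atBot (𝓝 ω)

/-- The average action of the configuration `x` exists and equals `b`. -/
def HasAverageAction (S : ℝ → ℝ → ℝ) (x : ℤ → ℝ) (b : ℝ) : Prop :=
  Tendsto (fun N : ℕ => 1 / (2 * (N : ℝ)) * segmentAction S x (-(N : ℤ)) (N : ℤ)) atTop (𝓝 b)

/-- `b` is the minimal average action at rotation number `ω`: there is an action-minimizing
configuration of rotation number `ω`, and each of these has average action `b`. -/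
def IsMinimalAverageAction (S : ℝ → ℝ → ℝ) (ω b : ℝ) : Prop :=
  (∃ x : ℤ → ℝ, IsMinimalConfiguration S x ∧ HasRotationNumber x ω) ∧
    ∀ x : ℤ → ℝ, IsMinimalConfiguration S x → HasRotationNumber x ω → HasAverageAction S x b

/-- Mather's beta function of the outer billiard in the exterior of `Ω`. -/
def betaOut (Ω : Set Plane) (ω : ℝ) : ℝ :=
  Classical.epsilon (IsMinimalAverageAction (generatingFunction Ω) ω)

end OuterBilliard

end

open MeasureTheory Filter Topology

noncomputable section

namespace OuterBilliard

/-! ### The cross product of the plane -/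

/-- The determinant of two vectors of the plane. -/
def cross (p q : Plane) : ℝ := p 0 * q 1 - p 1 * q 0

lemma cross_add_left (p q r : Plane) : cross (p + q) r = cross p r + cross q r := by
  simp [cross]; ring

lemma cross_add_right (p q r : Plane) : cross p (q + r) = cross p q + cross p r := by
  simp [cross]; ring

lemma cross_sub_left (p q r : Plane) : cross (p - q) r = cross p r - cross q r := by
  simp [cross]; ring

lemma cross_sub_right (p q r : Plane) : cross p (q - r) = cross p q - cross p r := by
  simp [cross]; ring

lemma cross_smul_left (c : ℝ) (p q : Plane) : cross (c • p) q = c * cross p q := by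
  simp [cross]; ring

lemma cross_smul_right (c : ℝ) (p q : Plane) : cross p (c • q) = c * cross p q := by
  simp [cross]; ring

lemma cross_neg_left (p q : Plane) : cross (-p) q = -cross p q := by
  simp [cross]; ring

lemma cross_neg_right (p q : Plane) : cross p (-q) = -cross p q := by
  simp [cross]; ring

@[simp] lemma cross_self (p : Plane) : cross p p = 0 := by
  simp [cross]; ring

@[simp] lemma cross_zero_left (p : Plane) : cross 0 p = 0 := by
  simp [cross]

@[simp] lemma cross_zero_right (p : Plane) : cross p 0 = 0 := by
  simp [cross]

lemma cross_swap (p q : Plane) : cross p q = -cross q p := by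
  simp [cross]; ring

lemma plane_ext {p q : Plane} (h0 : p 0 = q 0) (h1 : p 1 = q 1) : p = q := by
  ext i; fin_cases i <;> assumption

lemma eq_smul_add_smul {v w : Plane} (h : cross v w ≠ 0) (p : Plane) :
    p = (cross p w / cross v w) • v + (cross v p / cross v w) • w := by
  apply plane_ext
  · simp only [PiLp.add_apply, PiLp.smul_apply, smul_eq_mul]
    field_simp
    simp only [cross]; ring
  · simp only [PiLp.add_apply, PiLp.smul_apply, smul_eq_mul]
    field_simp
    simp only [cross]; ring

lemma exists_smul_of_cross_eq_zero {v m : Plane} (hm : m ≠ 0) (h : cross v m = 0) :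
    ∃ c : ℝ, v = c • m := by
  have key : v 0 * m 1 = v 1 * m 0 := by simpa [cross, sub_eq_zero] using h
  by_cases h0 : m 0 = 0
  · have h1 : m 1 ≠ 0 := fun h1 => hm (plane_ext (by simpa using h0) (by simpa using h1))
    refine ⟨v 1 / m 1, plane_ext ?_ ?_⟩
    · simp only [PiLp.smul_apply, smul_eq_mul]
      field_simp; linarith
    · simp only [PiLp.smul_apply, smul_eq_mul]
      field_simp
  · refine ⟨v 0 / m 0, plane_ext ?_ ?_⟩
    · simp only [PiLp.smul_apply, smul_eq_mul]
      field_simp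
    · simp only [PiLp.smul_apply, smul_eq_mul]
      field_simp; linarith

lemma continuous_cross : Continuous fun z : Plane × Plane => cross z.1 z.2 := by
  unfold cross; fun_prop

lemma Continuous.cross {X : Type*} [TopologicalSpace X] {f g : X → Plane} (hf : Continuous f)
    (hg : Continuous g) : Continuous fun t => OuterBilliard.cross (f t) (g t) :=
  continuous_cross.comp (hf.prodMk hg)

lemma HasDerivAt.coord {f : ℝ → Plane} {f' : Plane} {t : ℝ} (hf : HasDerivAt f f' t) (i : Fin 2) :
    HasDerivAt (fun s => f s i) (f' i) t :=
  (EuclideanSpace.proj (𝕜 := ℝ) i).hasFDerivAt.comp_hasDerivAt t hf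

lemma HasDerivAt.cross {f g : ℝ → Plane} {f' g' : Plane} {t : ℝ} (hf : HasDerivAt f f' t)
    (hg : HasDerivAt g g' t) :
    HasDerivAt (fun s => OuterBilliard.cross (f s) (g s))
      (OuterBilliard.cross f' (g t) + OuterBilliard.cross (f t) g') t := by
  have := ((HasDerivAt.coord hf 0).mul (HasDerivAt.coord hg 1)).sub
    ((HasDerivAt.coord hf 1).mul (HasDerivAt.coord hg 0))
  refine this.congr_deriv ?_
  simp only [OuterBilliard.cross]; ring

lemma HasDerivAt.cross_const {f : ℝ → Plane} {f' : Plane} {t : ℝ} (hf : HasDerivAt f f' t)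
    (m : Plane) : HasDerivAt (fun s => OuterBilliard.cross (f s) m)
      (OuterBilliard.cross f' m) t := by
  simpa using HasDerivAt.cross hf (hasDerivAt_const t m)

lemma HasDerivAt.const_cross {f : ℝ → Plane} {f' : Plane} {t : ℝ} (m : Plane)
    (hf : HasDerivAt f f' t) : HasDerivAt (fun s => OuterBilliard.cross m (f s))
      (OuterBilliard.cross m f') t := by
  simpa using HasDerivAt.cross (hasDerivAt_const t m) hf

/-! ### Unit vectors -/

lemma cross_dir (a b : ℝ) : cross (dir a) (dir b) = Real.sin (b - a) := by
  simp [cross, dir, Real.sin_sub]; ring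

lemma dir_add_pi (a : ℝ) : dir (a + Real.pi) = -dir a := by
  apply plane_ext <;> simp [dir]

lemma dir_add_two_pi (a : ℝ) : dir (a + 2 * Real.pi) = dir a := by
  apply plane_ext <;> simp [dir]

lemma dir_ne_zero (a : ℝ) : dir a ≠ 0 := by
  intro h
  have h0 := congrArg (fun p : Plane => p 0) h
  have h1 := congrArg (fun p : Plane => p 1) h
  simp only [dir] at h0 h1
  have := Real.cos_sq_add_sin_sq a
  simp at h0 h1
  rw [h0, h1] at this
  norm_num at this

lemma dir_add (a b : ℝ) :
    dir (a + b) = Real.cos b • dir a + Real.sin b • dir (a + Real.pi / 2) := by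
  apply plane_ext
  · simp [dir, Real.cos_add, Real.sin_add]; ring
  · simp [dir, Real.cos_add, Real.sin_add]; ring

lemma dir_eq (a : ℝ) : dir a = Real.cos a • (EuclideanSpace.single 0 1 : Plane) +
    Real.sin a • (EuclideanSpace.single 1 1 : Plane) := by
  apply plane_ext <;> simp [dir]

lemma hasDerivAt_dir (a : ℝ) : HasDerivAt dir (dir (a + Real.pi / 2)) a := by
  have h := ((Real.hasDerivAt_cos a).smul_const (EuclideanSpace.single 0 1 : Plane)).add
    ((Real.hasDerivAt_sin a).smul_const (EuclideanSpace.single 1 1 : Plane))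
  rw [funext dir_eq]
  refine h.congr_deriv ?_
  simp only [Real.cos_add_pi_div_two, Real.sin_add_pi_div_two]

lemma contDiff_dir {n : WithTop ℕ∞} : ContDiff ℝ n dir := by
  rw [contDiff_euclidean]
  intro i
  fin_cases i
  · simpa [dir] using Real.contDiff_cos
  · simpa [dir] using Real.contDiff_sin

lemma norm_dir (a : ℝ) : ‖dir a‖ = 1 := by
  simp [EuclideanSpace.norm_eq, dir, Fin.sum_univ_two]

lemma exists_eq_norm_smul_dir (p : Plane) : ∃ θ : ℝ, p = ‖p‖ • dir θ := by
  set z : ℂ := ⟨p 0, p 1⟩ with hz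
  have hn : ‖p‖ = ‖z‖ := by
    rw [EuclideanSpace.norm_eq, Complex.norm_eq_sqrt_sq_add_sq, Fin.sum_univ_two]
    simp [hz]
  refine ⟨z.arg, ?_⟩
  rw [hn]
  apply plane_ext
  · simp [dir, Complex.norm_mul_cos_arg, hz]
  · simp [dir, Complex.norm_mul_sin_arg, hz]

/-- Polar form of a vector given in a rotating orthonormal frame. -/
lemma smul_dir_add_smul_dir {c d : ℝ} (hd : 0 < d) (β : ℝ) :
    d • dir β + c • dir (β + Real.pi / 2) =
      Real.sqrt (c ^ 2 + d ^ 2) • dir (β + Real.arctan (c / d)) := by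
  have h1 : Real.sqrt (1 + (c / d) ^ 2) = Real.sqrt (c ^ 2 + d ^ 2) / d := by
    rw [show 1 + (c / d) ^ 2 = (c ^ 2 + d ^ 2) / d ^ 2 by field_simp; ring,
      Real.sqrt_div' _ (by positivity), Real.sqrt_sq hd.le]
  have hs : Real.sqrt (c ^ 2 + d ^ 2) ≠ 0 := by positivity
  rw [dir_add β (Real.arctan _), Real.cos_arctan, Real.sin_arctan, h1, smul_add, smul_smul, smul_smul]
  congr 2
  · field_simp
  · field_simp

/-! ### Support functionals and tangent vectors -/

lemma IsTable.convex {Ω : Set Plane} (h : IsTable Ω) : Convex ℝ Ω := h.strictConvex.convex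

lemma IsTable.mem_nhds {Ω : Set Plane} (h : IsTable Ω) : Ω ∈ 𝓝 (0 : Plane) :=
  mem_interior_iff_mem_nhds.mp h.zero_mem

lemma exists_cross_eq (f : Plane →L[ℝ] ℝ) : ∃ m : Plane, ∀ q, f q = cross q m := by
  refine ⟨!₂[-f (EuclideanSpace.single 1 1), f (EuclideanSpace.single 0 1)], fun q => ?_⟩
  have hq : q = q 0 • EuclideanSpace.single 0 1 + q 1 • EuclideanSpace.single 1 1 := by
    apply plane_ext <;> simp
  conv_lhs => rw [hq]
  simp only [map_add, map_smul, smul_eq_mul, cross]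
  simp

/-- The line `cross q m = 1` supports `Ω` at the point `p`. -/
def Supports (Ω : Set Plane) (p m : Plane) : Prop := cross p m = 1 ∧ ∀ q ∈ Ω, cross q m ≤ 1

lemma Supports.ne_zero {Ω : Set Plane} {p m : Plane} (h : Supports Ω p m) : m ≠ 0 := by
  rintro rfl
  simpa using h.1

lemma IsTable.exists_supports {Ω : Set Plane} (h : IsTable Ω) {p : Plane}
    (hp : p ∈ frontier Ω) : ∃ m, Supports Ω p m := by
  have hpi : p ∉ interior Ω := hp.2
  obtain ⟨f, hf⟩ := geometric_hahn_banach_open_point h.convex.interior isOpen_interior hpi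
  have hfp : 0 < f p := by simpa using hf 0 h.zero_mem
  obtain ⟨m, hm⟩ := exists_cross_eq ((f p)⁻¹ • f)
  refine ⟨m, ?_, fun q hq => ?_⟩
  · rw [← hm]; simp [hfp.ne']
  · have hcl : q ∈ closure (interior Ω) := by
      rw [h.convex.closure_interior_eq_closure_of_nonempty_interior ⟨0, h.zero_mem⟩]
      exact subset_closure hq
    have hle : f q ≤ f p := by
      have : closure (interior Ω) ⊆ {q | f q ≤ f p} :=
        closure_minimal (fun z hz => (hf z hz).le) (isClosed_le f.continuous continuous_const)
      exact this hcl
    rw [← hm]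
    simp only [smul_apply, smul_eq_mul]
    rw [inv_mul_le_iff₀ hfp]; simpa using hle

lemma IsTable.frontier_subset {Ω : Set Plane} (h : IsTable Ω) : frontier Ω ⊆ Ω :=
  h.isCompact.isClosed.frontier_subset

lemma Supports.mem_frontier {Ω : Set Plane} {p m : Plane} (hs : Supports Ω p m) (hp : p ∈ Ω) :
    p ∈ frontier Ω := by
  refine ⟨subset_closure hp, fun hpi => ?_⟩
  have hc : Continuous fun t : ℝ => (1 + t) • p := by fun_prop
  have h0 : ∀ᶠ t in 𝓝 (0 : ℝ), (1 + t) • p ∈ interior Ω :=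
    hc.continuousAt.eventually_mem (by simpa using isOpen_interior.mem_nhds hpi)
  obtain ⟨t, ht, ht0⟩ := ((h0.filter_mono nhdsWithin_le_nhds).and
    (self_mem_nhdsWithin : Set.Ioi (0 : ℝ) ∈ 𝓝[>] 0)).exists
  have := hs.2 _ (interior_subset ht)
  rw [cross_smul_left, hs.1] at this
  have : (0 : ℝ) < t := ht0
  linarith

lemma IsC2Param.hasDerivAt {Γ : Set Plane} {γ : ℝ → Plane} (h : IsC2Param Γ γ) (t : ℝ) :
    HasDerivAt γ (deriv γ t) t :=
  (h.contDiff.differentiable (by norm_num) t).hasDerivAt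

lemma IsTable.cross_deriv_eq_zero {Ω : Set Plane} (h : IsTable Ω) {p m : Plane}
    (hs : Supports Ω p m) {γ : ℝ → Plane} (hγ : IsC2Param (frontier Ω) γ) {t : ℝ} (ht : γ t = p) :
    cross (deriv γ t) m = 0 := by
  have hd := HasDerivAt.cross_const (hγ.hasDerivAt t) m
  refine IsLocalMax.hasDerivAt_eq_zero (Eventually.of_forall fun s => ?_) hd
  change cross (γ s) m ≤ cross (γ t) m
  rw [ht, hs.1]
  exact hs.2 _ (h.frontier_subset (hγ.range_eq ▸ Set.mem_range_self s))

lemma IsTable.isTangentVector_iff {Ω : Set Plane} (h : IsTable Ω) {p m : Plane}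
    (hp : p ∈ frontier Ω) (hs : Supports Ω p m) (v : Plane) :
    IsTangentVector (frontier Ω) p v ↔ v ≠ 0 ∧ cross v m = 0 := by
  constructor
  · rintro ⟨hv, γ, hγ, t, c, ht, rfl⟩
    exact ⟨hv, by rw [cross_smul_left, h.cross_deriv_eq_zero hs hγ ht, mul_zero]⟩
  · rintro ⟨hv, hvm⟩
    obtain ⟨γ, hγ⟩ := h.boundary
    obtain ⟨t, ht⟩ := hγ.range_eq.symm ▸ hp
    obtain ⟨c, hc⟩ := exists_smul_of_cross_eq_zero hs.ne_zero (h.cross_deriv_eq_zero hs hγ ht)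
    obtain ⟨d, hd⟩ := exists_smul_of_cross_eq_zero hs.ne_zero hvm
    have hc0 : c ≠ 0 := by
      rintro rfl
      exact hγ.regular t (by simpa using hc)
    refine ⟨hv, γ, hγ, t, d / c, ht, ?_⟩
    rw [hc, hd, smul_smul, div_mul_cancel₀ _ hc0]

/-! ### The generating function as a maximum -/

lemma IsMidpointTangentSegment.le_one {Ω : Set Plane} (h : IsTable Ω) {φ₁ φ₂ a b : ℝ}
    (hs : IsMidpointTangentSegment Ω φ₁ φ₂ a b) :
    (a / 2) • dir φ₁ + (b / 2) • dir φ₂ ∈ Ω ∧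
    ∀ s t : ℝ, s • dir φ₁ + t • dir φ₂ ∈ Ω → s / a + t / b ≤ 1 := by
  obtain ⟨ha, hb, ht⟩ := hs
  have hmid : midpoint ℝ (a • dir φ₁) (b • dir φ₂) = (a / 2) • dir φ₁ + (b / 2) • dir φ₂ := by
    rw [midpoint_eq_smul_add, smul_add, smul_smul, smul_smul]
    congr 2 <;> simp <;> ring
  rw [hmid] at ht
  have hp : (a / 2) • dir φ₁ + (b / 2) • dir φ₂ ∈ frontier Ω := by
    obtain ⟨-, γ, hγ, t, c, htp, -⟩ := ht
    rw [← htp, ← hγ.range_eq]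
    exact Set.mem_range_self t
  obtain ⟨m, hm⟩ := h.exists_supports hp
  have hv := ((h.isTangentVector_iff hp hm _).1 ht).2
  refine ⟨h.frontier_subset hp, fun s t hst => ?_⟩
  have h1 := hm.1
  have h2 := hm.2 _ hst
  simp only [cross_add_left, cross_sub_left, cross_smul_left] at h1 h2 hv
  have e1 : cross (dir φ₁) m = 1 / a := by field_simp; linarith
  have e2 : cross (dir φ₂) m = 1 / b := by field_simp; linarith
  rw [e1, e2] at h2
  calc s / a + t / b = s * (1 / a) + t * (1 / b) := by ring
    _ ≤ 1 := h2

lemma mul_le_of_div_add_div_le_one {s t s' t' : ℝ} (hs : 0 < s) (ht : 0 < t) (ht' : 0 ≤ t')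
    (h : s' / (2 * s) + t' / (2 * t) ≤ 1) : s' * t' ≤ s * t := by
  have h1 : s' * t + t' * s ≤ 2 * (s * t) := by
    have := mul_le_mul_of_nonneg_right h (by positivity : 0 ≤ 2 * (s * t))
    calc s' * t + t' * s = (s' / (2 * s) + t' / (2 * t)) * (2 * (s * t)) := by
          field_simp
      _ ≤ _ := by simpa using this
  rcases le_or_gt s' 0 with h0 | h0
  · nlinarith [mul_pos hs ht, mul_nonneg (neg_nonneg.2 h0) ht']
  · have h2 : 0 ≤ s' * t + t' * s := by positivity
    have h3 : 4 * ((s' * t') * (s * t)) ≤ 4 * ((s * t) * (s * t)) := by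
      nlinarith [sq_nonneg (s' * t - t' * s), mul_pos hs ht]
    have := mul_pos hs ht
    exact le_of_mul_le_mul_right (by linarith) this

lemma IsTable.exists_isMidpointTangentSegment {Ω : Set Plane} (h : IsTable Ω) {φ₁ φ₂ : ℝ}
    (hadm : Admissible φ₁ φ₂) : ∃ a b : ℝ, IsMidpointTangentSegment Ω φ₁ φ₂ a b := by
  have hc : 0 < cross (dir φ₁) (dir φ₂) := by
    rw [cross_dir]
    exact Real.sin_pos_of_pos_of_lt_pi (by linarith [hadm.1]) (by linarith [hadm.2])
  set d₁ := dir φ₁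
  set d₂ := dir φ₂
  set c := cross d₁ d₂
  have c1 : Continuous fun p : Plane => cross p d₂ := Continuous.cross continuous_id continuous_const
  have c2 : Continuous fun p : Plane => cross d₁ p := Continuous.cross continuous_const continuous_id
  set K : Set Plane := Ω ∩ ({p | 0 ≤ cross p d₂} ∩ {p | 0 ≤ cross d₁ p})
  have hK : IsCompact K := h.isCompact.inter_right
    ((isClosed_le continuous_const c1).inter (isClosed_le continuous_const c2))
  obtain ⟨ε, hε, hεΩ⟩ : ∃ ε : ℝ, 0 < ε ∧ ε • (d₁ + d₂) ∈ Ω := by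
    have hcont : Continuous fun t : ℝ => t • (d₁ + d₂) := by fun_prop
    have h0 : ∀ᶠ t in 𝓝 (0 : ℝ), t • (d₁ + d₂) ∈ Ω :=
      hcont.continuousAt.eventually_mem (by simpa using h.mem_nhds)
    obtain ⟨t, ht, ht0⟩ := ((h0.filter_mono nhdsWithin_le_nhds).and
      (self_mem_nhdsWithin : Set.Ioi (0 : ℝ) ∈ 𝓝[>] 0)).exists
    exact ⟨t, ht0, ht⟩
  have e1 : cross (ε • (d₁ + d₂)) d₂ = ε * c := by
    simp [cross_smul_left, cross_add_left, c]
  have e2 : cross d₁ (ε • (d₁ + d₂)) = ε * c := by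
    simp [cross_smul_right, cross_add_right, c]
  have hεK : ε • (d₁ + d₂) ∈ K :=
    ⟨hεΩ, by simp only [Set.mem_ofPred_eq, e1]; positivity,
      by simp only [Set.mem_ofPred_eq, e2]; positivity⟩
  obtain ⟨p, ⟨hpΩ, hp1, hp2⟩, hmax⟩ := hK.exists_isMaxOn ⟨_, hεK⟩ (c1.mul c2).continuousOn
  have hmax' : ∀ q ∈ K, cross q d₂ * cross d₁ q ≤ cross p d₂ * cross d₁ p := fun q hq => hmax hq
  simp only [Set.mem_ofPred_eq] at hp1 hp2
  have hprod : 0 < cross p d₂ * cross d₁ p := by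
    have := hmax' _ hεK
    rw [e1, e2] at this
    exact lt_of_lt_of_le (by positivity) this
  have hp1' : 0 < cross p d₂ := lt_of_le_of_ne hp1 fun h0 => by simp [← h0] at hprod
  have hp2' : 0 < cross d₁ p := lt_of_le_of_ne hp2 fun h0 => by simp [← h0] at hprod
  have key : ∀ q ∈ Ω, cross q d₂ * cross d₁ p + cross d₁ q * cross p d₂ ≤
      2 * (cross p d₂ * cross d₁ p) := by
    intro q hq
    by_contra hlt
    push Not at hlt
    set u := cross q d₂ - cross p d₂ with hu
    set w := cross d₁ q - cross d₁ p with hw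
    have hpos : 0 < u * cross d₁ p + w * cross p d₂ := by
      simp only [hu, hw]; nlinarith
    have E : ∀ᶠ r in 𝓝 (0 : ℝ), 0 < cross p d₂ + r * u ∧ 0 < cross d₁ p + r * w ∧
        0 < (u * cross d₁ p + w * cross p d₂) + r * (u * w) ∧ r < 1 := by
      refine Filter.Eventually.and ?_ (Filter.Eventually.and ?_ (Filter.Eventually.and ?_ ?_))
      · exact ContinuousAt.eventually_lt continuousAt_const (by fun_prop) (by simpa using hp1')
      · exact ContinuousAt.eventually_lt continuousAt_const (by fun_prop) (by simpa using hp2')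
      · exact ContinuousAt.eventually_lt continuousAt_const (by fun_prop) (by simpa using hpos)
      · exact eventually_lt_nhds one_pos
    obtain ⟨r, ⟨h1, h2, h3, h4⟩, hr0⟩ := ((E.filter_mono nhdsWithin_le_nhds).and
      (self_mem_nhdsWithin : Set.Ioi (0 : ℝ) ∈ 𝓝[>] 0)).exists
    replace hr0 : 0 < r := hr0
    have hmem : (1 - r) • p + r • q ∈ Ω :=
      h.convex hpΩ hq (by linarith) hr0.le (by ring)
    have f1 : cross ((1 - r) • p + r • q) d₂ = cross p d₂ + r * u := by
      simp only [cross_add_left, cross_smul_left, hu]; ring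
    have f2 : cross d₁ ((1 - r) • p + r • q) = cross d₁ p + r * w := by
      simp only [cross_add_right, cross_smul_right, hw]; ring
    have := hmax' ((1 - r) • p + r • q)
      ⟨hmem, by simp only [Set.mem_ofPred_eq, f1]; exact h1.le,
        by simp only [Set.mem_ofPred_eq, f2]; exact h2.le⟩
    rw [f1, f2] at this
    nlinarith [mul_pos hr0 h3]
  set s := cross p d₂ / c with hs
  set t := cross d₁ p / c with ht
  have hs0 : 0 < s := by positivity
  have ht0 : 0 < t := by positivity
  have hpst : p = s • d₁ + t • d₂ := eq_smul_add_smul hc.ne' p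
  set m : Plane := (1 / (2 * cross p d₂)) • d₂ - (1 / (2 * cross d₁ p)) • d₁ with hm
  have hcm' : ∀ q, cross q m = (cross q d₂ * cross d₁ p + cross d₁ q * cross p d₂) /
      (2 * (cross p d₂ * cross d₁ p)) := by
    intro q
    simp only [hm, cross_sub_right, cross_smul_right, cross_swap q d₁]
    field_simp
    ring
  have hsup : Supports Ω p m := by
    refine ⟨?_, fun q hq => ?_⟩
    · rw [hcm']; field_simp; ring
    · rw [hcm', div_le_one (by positivity)]; exact key q hq
  refine ⟨2 * s, 2 * t, by positivity, by positivity, ?_⟩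
  change IsTangentVector (frontier Ω) (midpoint ℝ ((2 * s) • d₁) ((2 * t) • d₂))
    ((2 * t) • d₂ - (2 * s) • d₁)
  have hmid : midpoint ℝ ((2 * s) • d₁) ((2 * t) • d₂) = p := by
    rw [hpst, midpoint_eq_smul_add, smul_add, smul_smul, smul_smul]
    congr 2 <;> simp
  rw [hmid, h.isTangentVector_iff (hsup.mem_frontier hpΩ) hsup]
  constructor
  · intro h0
    have := congrArg (fun z => cross z d₂) h0
    simp only [cross_sub_left, cross_smul_left, cross_self, cross_zero_left] at this
    have h2 : 0 < 2 * s * c := by positivity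
    linarith
  · rw [hcm']
    simp only [cross_sub_left, cross_sub_right, cross_smul_left, cross_smul_right, cross_self]
    rw [hs, ht]
    field_simp
    simp only [mul_zero, zero_sub]
    ring

/-- The optimal triangle: the generating function in terms of the tangency point. -/
lemma IsTable.exists_optimal {Ω : Set Plane} (h : IsTable Ω) {φ₁ φ₂ : ℝ}
    (hadm : Admissible φ₁ φ₂) : ∃ s t : ℝ, 0 < s ∧ 0 < t ∧ s • dir φ₁ + t • dir φ₂ ∈ Ω ∧
      (∀ s' t' : ℝ, s' • dir φ₁ + t' • dir φ₂ ∈ Ω → s' / (2 * s) + t' / (2 * t) ≤ 1) ∧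
      generatingFunction Ω φ₁ φ₂ = 2 * s * t * Real.sin (φ₂ - φ₁) := by
  obtain ⟨a, b, hab⟩ := h.exists_isMidpointTangentSegment hadm
  obtain ⟨hmem, hle⟩ := hab.le_one h
  have ha := hab.1
  have hb := hab.2.1
  refine ⟨a / 2, b / 2, by positivity, by positivity, hmem, fun s' t' h' => ?_, ?_⟩
  · rw [mul_div_cancel₀ _ two_ne_zero, mul_div_cancel₀ _ two_ne_zero]; exact hle s' t' h'
  · have hex : ∃ σ : ℝ, ∃ a b : ℝ, IsMidpointTangentSegment Ω φ₁ φ₂ a b ∧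
        σ = a * b * Real.sin (φ₂ - φ₁) / 2 := ⟨_, a, b, hab, rfl⟩
    obtain ⟨a', b', hab', hS⟩ := Classical.epsilon_spec hex
    obtain ⟨hmem', hle'⟩ := hab'.le_one h
    have ha' := hab'.1
    have hb' := hab'.2.1
    have h1 : a' / 2 * (b' / 2) ≤ a / 2 * (b / 2) :=
      mul_le_of_div_add_div_le_one (by positivity) (by positivity) (by positivity)
        (by rw [mul_div_cancel₀ _ two_ne_zero, mul_div_cancel₀ _ two_ne_zero]; exact hle _ _ hmem')
    have h2 : a / 2 * (b / 2) ≤ a' / 2 * (b' / 2) :=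
      mul_le_of_div_add_div_le_one (by positivity) (by positivity) (by positivity)
        (by rw [mul_div_cancel₀ _ two_ne_zero, mul_div_cancel₀ _ two_ne_zero]; exact hle' _ _ hmem)
    have h3 : a' * b' = a * b := by linarith
    change generatingFunction Ω φ₁ φ₂ = _ at hS
    rw [hS, h3]; ring

/-! ### The radial function -/

/-- The radial function of a table in polar coordinates. -/
def radial (Ω : Set Plane) (θ : ℝ) : ℝ := (gauge Ω (dir θ))⁻¹

lemma IsTable.gauge_pos {Ω : Set Plane} (h : IsTable Ω) {p : Plane} (hp : p ≠ 0) :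
    0 < gauge Ω p :=
  (_root_.gauge_pos (absorbent_nhds_zero h.mem_nhds)
    (NormedSpace.isVonNBounded_iff ℝ |>.2 h.isCompact.isBounded)).2 hp

lemma IsTable.mem_iff_gauge_le_one {Ω : Set Plane} (h : IsTable Ω) (p : Plane) :
    p ∈ Ω ↔ gauge Ω p ≤ 1 := by
  rw [gauge_le_one_iff_mem_closure h.convex h.mem_nhds, h.isCompact.isClosed.closure_eq]

lemma IsTable.radial_pos {Ω : Set Plane} (h : IsTable Ω) (θ : ℝ) : 0 < radial Ω θ :=
  inv_pos.2 (h.gauge_pos (dir_ne_zero θ))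

lemma IsTable.smul_dir_mem_iff {Ω : Set Plane} (h : IsTable Ω) {ρ : ℝ} (hρ : 0 ≤ ρ) (θ : ℝ) :
    ρ • dir θ ∈ Ω ↔ ρ ≤ radial Ω θ := by
  rw [h.mem_iff_gauge_le_one, gauge_smul_of_nonneg hρ, smul_eq_mul, radial, inv_eq_one_div,
    le_div_iff₀ (h.gauge_pos (dir_ne_zero θ))]

lemma IsTable.smul_dir_mem_frontier_iff {Ω : Set Plane} (h : IsTable Ω) {ρ : ℝ} (hρ : 0 ≤ ρ)
    (θ : ℝ) : ρ • dir θ ∈ frontier Ω ↔ ρ = radial Ω θ := by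
  have := h.gauge_pos (dir_ne_zero θ)
  rw [← gauge_eq_one_iff_mem_frontier h.convex h.mem_nhds, gauge_smul_of_nonneg hρ, smul_eq_mul,
    radial, inv_eq_one_div, eq_div_iff this.ne']

lemma IsTable.cross_deriv_ne_zero {Ω : Set Plane} (h : IsTable Ω) {γ : ℝ → Plane}
    (hγ : IsC2Param (frontier Ω) γ) (t : ℝ) : cross (γ t) (deriv γ t) ≠ 0 := by
  intro h0
  have hmem : γ t ∈ frontier Ω := hγ.range_eq ▸ Set.mem_range_self t
  obtain ⟨m, hm⟩ := h.exists_supports hmem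
  have h1 := h.cross_deriv_eq_zero hm hγ rfl
  obtain ⟨c, hc⟩ := exists_smul_of_cross_eq_zero (hγ.regular t) h0
  have h2 := hm.1
  rw [hc, cross_smul_left, h1, mul_zero] at h2
  exact zero_ne_one h2

lemma IsTable.contDiff_radial {Ω : Set Plane} (h : IsTable Ω) : ContDiff ℝ 2 (radial Ω) := by
  rw [contDiff_iff_contDiffAt]
  intro θ₀
  obtain ⟨γ, hγ⟩ := h.boundary
  have hmem₀ : radial Ω θ₀ • dir θ₀ ∈ frontier Ω :=
    (h.smul_dir_mem_frontier_iff (h.radial_pos θ₀).le θ₀).2 rfl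
  obtain ⟨t₀, ht₀⟩ := hγ.range_eq.symm ▸ hmem₀
  have hr₀ := h.radial_pos θ₀
  have hunit : cross (dir θ₀) (dir (θ₀ + Real.pi / 2)) = 1 := by rw [cross_dir]; simp
  set c : ℝ → ℝ := fun t => cross (dir θ₀) (γ t) with hc
  set d : ℝ → ℝ := fun t => cross (γ t) (dir (θ₀ + Real.pi / 2)) with hd
  have hγc : ContDiff ℝ 2 γ := hγ.contDiff
  have hγi : ∀ i, ContDiff ℝ 2 fun t => γ t i := fun i => contDiff_euclidean.1 hγc i
  have hcC : ContDiff ℝ 2 c := by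
    simp only [hc, cross]
    exact (contDiff_const.mul (hγi 1)).sub (contDiff_const.mul (hγi 0))
  have hdC : ContDiff ℝ 2 d := by
    simp only [hd, cross]
    exact ((hγi 0).mul contDiff_const).sub ((hγi 1).mul contDiff_const)
  have hc0 : c t₀ = 0 := by simp [hc, ht₀, cross_smul_right]
  have hd0 : d t₀ = radial Ω θ₀ := by simp only [hd, ht₀, cross_smul_left, hunit, mul_one]
  have hdpos : ∀ᶠ t in 𝓝 t₀, 0 < d t :=
    ContinuousAt.eventually_lt continuousAt_const hdC.continuous.continuousAt (by rw [hd0]; exact hr₀)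
  set α : ℝ → ℝ := fun t => Real.arctan (c t / d t) with hα
  have hαC : ContDiffAt ℝ 2 α t₀ :=
    Real.contDiff_arctan.contDiffAt.comp t₀
      (hcC.contDiffAt.div hdC.contDiffAt (by rw [hd0]; exact hr₀.ne'))
  have hα0 : α t₀ = 0 := by simp [hα, hc0]
  have hcd : HasDerivAt c (cross (dir θ₀) (deriv γ t₀)) t₀ :=
    HasDerivAt.const_cross _ (hγ.hasDerivAt t₀)
  have hc' : cross (dir θ₀) (deriv γ t₀) ≠ 0 := by
    have := h.cross_deriv_ne_zero hγ t₀
    rw [ht₀, cross_smul_left] at this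
    exact right_ne_zero_of_mul this
  have hdd : HasDerivAt d (deriv d t₀) t₀ :=
    (hdC.differentiable (by norm_num) t₀).hasDerivAt
  have hαd : HasDerivAt α (cross (dir θ₀) (deriv γ t₀) / radial Ω θ₀) t₀ := by
    have := (hcd.div hdd (by rw [hd0]; exact hr₀.ne')).arctan
    refine this.congr_deriv ?_
    rw [Pi.div_apply, hc0, hd0]
    field_simp
    ring
  have hα' : cross (dir θ₀) (deriv γ t₀) / radial Ω θ₀ ≠ 0 := div_ne_zero hc' hr₀.ne'
  have hαf := hαd.hasFDerivAt_equiv hα'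
  have h2 : (2 : WithTop ℕ∞) ≠ 0 := two_ne_zero
  set β := hαC.localInverse hαf h2 with hβ
  have hβC : ContDiffAt ℝ 2 β 0 := hα0 ▸ hαC.to_localInverse hαf h2
  have hβ0 : β 0 = t₀ := by
    have := hαC.localInverse_apply_image hαf h2
    rwa [hα0] at this
  have hright : ∀ᶠ s in 𝓝 (0 : ℝ), α (β s) = s := by
    have := (hαC.hasStrictFDerivAt' hαf h2).eventually_right_inverse
    rwa [hα0] at this
  have hβt : Tendsto β (𝓝 0) (𝓝 t₀) := hβ0 ▸ hβC.continuousAt.tendsto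
  have heq : ∀ᶠ s in 𝓝 (0 : ℝ), radial Ω (θ₀ + s) = Real.sqrt (c (β s) ^ 2 + d (β s) ^ 2) := by
    filter_upwards [hright, hβt.eventually hdpos] with s hs hds
    have hp : γ (β s) = d (β s) • dir θ₀ + c (β s) • dir (θ₀ + Real.pi / 2) := by
      have := eq_smul_add_smul (by rw [hunit]; exact one_ne_zero) (γ (β s))
        (v := dir θ₀) (w := dir (θ₀ + Real.pi / 2))
      simpa only [hunit, div_one] using this
    rw [smul_dir_add_smul_dir hds] at hp
    change γ (β s) = _ • dir (θ₀ + α (β s)) at hp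
    rw [hs] at hp
    have hmem : γ (β s) ∈ frontier Ω := hγ.range_eq ▸ Set.mem_range_self _
    rw [hp, h.smul_dir_mem_frontier_iff (Real.sqrt_nonneg _)] at hmem
    exact hmem.symm
  have hsq : ContDiffAt ℝ 2 (fun s => Real.sqrt (c (β s) ^ 2 + d (β s) ^ 2)) 0 := by
    refine ContDiffAt.sqrt ?_ ?_
    · exact ((hcC.contDiffAt.comp 0 hβC).pow 2).add ((hdC.contDiffAt.comp 0 hβC).pow 2)
    · rw [hβ0, hc0, hd0]; positivity
  have h3 : ContDiffAt ℝ 2 (fun s => radial Ω (θ₀ + s)) 0 := hsq.congr_of_eventuallyEq heq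
  have h4 : ContDiffAt ℝ 2 (fun θ => radial Ω (θ₀ + (θ - θ₀))) θ₀ := by
    have : ContDiffAt ℝ 2 (fun θ : ℝ => θ - θ₀) θ₀ := contDiffAt_id.sub contDiffAt_const
    exact ContDiffAt.comp (g := fun s => radial Ω (θ₀ + s)) θ₀ (by simpa using h3) this
  simpa using h4

lemma IsRadonCurve.radial_add_pi {Ω : Set Plane} (h : IsTable Ω) (hR : IsRadonCurve (frontier Ω))
    (θ : ℝ) : radial Ω (θ + Real.pi) = radial Ω θ := by
  have h1 : radial Ω θ • dir θ ∈ frontier Ω :=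
    (h.smul_dir_mem_frontier_iff (h.radial_pos θ).le θ).2 rfl
  have h2 := hR.neg_mem _ h1
  rw [← smul_neg, ← dir_add_pi, h.smul_dir_mem_frontier_iff (h.radial_pos θ).le] at h2
  exact h2.symm

/-! ### The conjugate parametrization of a Radon curve -/

section Radial

variable {r r₁ r₂ : ℝ → ℝ}

lemma hasDerivAt_smul_dir (hr : ∀ t, HasDerivAt r (r₁ t) t) (t : ℝ) :
    HasDerivAt (fun s => r s • dir s) (r₁ t • dir t + r t • dir (t + Real.pi / 2)) t := by
  refine ((hr t).smul (hasDerivAt_dir t)).congr_deriv ?_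
  rw [add_comm]

lemma hasDerivAt_dir_shift (t : ℝ) :
    HasDerivAt (fun s => dir (s + Real.pi / 2)) (-dir t) t := by
  refine ((hasDerivAt_dir (t + Real.pi / 2)).comp_add_const t (Real.pi / 2)).congr_deriv ?_
  rw [add_assoc, add_halves, dir_add_pi]

/-- The normalized tangent vector of the curve `r s • dir s`. -/
def conormal (r r₁ : ℝ → ℝ) (t : ℝ) : Plane :=
  (r₁ t / r t ^ 2) • dir t + (1 / r t) • dir (t + Real.pi / 2)

lemma smul_conormal (hpos : ∀ t, 0 < r t) (t : ℝ) :
    r t ^ 2 • conormal r r₁ t = r₁ t • dir t + r t • dir (t + Real.pi / 2) := by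
  have := (hpos t).ne'
  rw [conormal, smul_add, smul_smul, smul_smul]
  congr 2
  · field_simp
  · field_simp

lemma cross_conormal (hpos : ∀ t, 0 < r t) (t : ℝ) :
    cross (r t • dir t) (conormal r r₁ t) = 1 := by
  have := (hpos t).ne'
  rw [conormal, cross_add_right, cross_smul_right, cross_smul_right, cross_smul_left,
    cross_smul_left, cross_dir, cross_dir]
  simp [this]

lemma hasDerivAt_conormal (hpos : ∀ t, 0 < r t) (hr : ∀ t, HasDerivAt r (r₁ t) t)
    (hr₁ : ∀ t, HasDerivAt r₁ (r₂ t) t) (t : ℝ) :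
    HasDerivAt (conormal r r₁)
      (-((1 / r t - (r₂ t * r t - 2 * r₁ t ^ 2) / r t ^ 3) / r t) • (r t • dir t)) t := by
  have h0 := (hpos t).ne'
  have h1 := ((hr₁ t).div ((hr t).pow 2) (pow_ne_zero 2 h0)).smul (hasDerivAt_dir t)
  have h2 := ((hr t).inv h0).smul (hasDerivAt_dir_shift t)
  have h3 := h1.add h2
  have e : conormal r r₁ = ((r₁ / r ^ 2) • dir + r⁻¹ • fun s => dir (s + Real.pi / 2)) := by
    ext1 s
    simp [conormal]
  rw [e]
  refine h3.congr_deriv ?_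
  apply plane_ext
  · simp
    field_simp
    ring
  · simp
    field_simp
    ring

end Radial

lemma IsTable.supports_conormal {Ω : Set Plane} (h : IsTable Ω) {r₁ : ℝ → ℝ}
    (hr : ∀ t, HasDerivAt (radial Ω) (r₁ t) t) (t : ℝ) :
    Supports Ω (radial Ω t • dir t) (conormal (radial Ω) r₁ t) := by
  have hmem : ∀ s, radial Ω s • dir s ∈ frontier Ω := fun s =>
    (h.smul_dir_mem_frontier_iff (h.radial_pos s).le s).2 rfl
  obtain ⟨m, hm⟩ := h.exists_supports (hmem t)
  have hd := HasDerivAt.cross_const (hasDerivAt_smul_dir hr t) m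
  rw [← smul_conormal h.radial_pos] at hd
  have h0 := IsLocalMax.hasDerivAt_eq_zero (Eventually.of_forall fun s => by
    rw [hm.1]; exact hm.2 _ (h.frontier_subset (hmem s))) hd
  rw [cross_smul_left] at h0
  have hr0 := (h.radial_pos t).ne'
  have h1 : cross (conormal (radial Ω) r₁ t) m = 0 :=
    (mul_eq_zero.1 h0).resolve_left (pow_ne_zero 2 hr0)
  have hc1 := cross_conormal (r₁ := r₁) h.radial_pos t
  have hne : conormal (radial Ω) r₁ t ≠ 0 := by
    intro h0; rw [h0] at hc1; simp at hc1
  obtain ⟨k, hk⟩ := exists_smul_of_cross_eq_zero (v := m) hne (by rw [cross_swap, h1, neg_zero])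
  have h2 := hm.1
  rw [hk, cross_smul_right, hc1, mul_one] at h2
  rw [h2, one_smul] at hk
  rw [← hk]; exact hm

/-- On a Radon curve, the gauge of the conormal does not depend on the point. -/
lemma IsRadonCurve.exists_gauge_conormal {Ω : Set Plane} (h : IsTable Ω)
    (hR : IsRadonCurve (frontier Ω)) {r₁ r₂ : ℝ → ℝ}
    (hr : ∀ t, HasDerivAt (radial Ω) (r₁ t) t) (hr₁ : ∀ t, HasDerivAt r₁ (r₂ t) t) :
    ∃ A : ℝ, 0 < A ∧ ∀ t, A • conormal (radial Ω) r₁ t ∈ frontier Ω := by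
  set x : ℝ → Plane := fun t => radial Ω t • dir t with hx
  set m := conormal (radial Ω) r₁ with hmdef
  have hpos := h.radial_pos
  have hxm : ∀ t, cross (x t) (m t) = 1 := cross_conormal hpos
  have hsup : ∀ t, Supports Ω (x t) (m t) := h.supports_conormal hr
  have hxf : ∀ t, x t ∈ frontier Ω := fun s => (h.smul_dir_mem_frontier_iff (hpos s).le s).2 rfl
  set D : ℝ → ℝ := fun t => (gauge Ω (m t))⁻¹ with hD
  have hgm : ∀ t, 0 < gauge Ω (m t) := fun t => h.gauge_pos (hsup t).ne_zero
  have hDpos : ∀ t, 0 < D t := fun t => inv_pos.2 (hgm t)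
  have hyf : ∀ t, D t • m t ∈ frontier Ω := by
    intro t
    rw [← gauge_eq_one_iff_mem_frontier h.convex h.mem_nhds, gauge_smul_of_nonneg (hDpos t).le,
      smul_eq_mul, inv_mul_cancel₀ (hgm t).ne']
  have hconj : ∀ t, ∀ q ∈ Ω, cross (x t) q ≤ D t := by
    intro t q hq
    have hxy : BirkhoffOrthogonal (frontier Ω) (x t) (D t • m t) :=
      (h.isTangentVector_iff (hxf t) (hsup t) _).2
        ⟨smul_ne_zero (hDpos t).ne' (hsup t).ne_zero, by rw [cross_smul_left, cross_self, mul_zero]⟩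
    have hyx := hR.symm _ (hxf t) _ (hyf t) hxy
    obtain ⟨n, hn⟩ := h.exists_supports (hyf t)
    obtain ⟨hx0, hxn⟩ := (h.isTangentVector_iff (hyf t) hn _).1 hyx
    obtain ⟨k, hk⟩ := exists_smul_of_cross_eq_zero (v := n) hx0 (by rw [cross_swap, hxn, neg_zero])
    have h1 := hn.1
    have h2 := hn.2 q hq
    rw [hk, cross_smul_right, cross_smul_left, cross_swap, hxm] at h1
    rw [hk, cross_smul_right, cross_swap] at h2
    have h3 : k = -1 / D t := by
      rw [eq_div_iff (hDpos t).ne']; linarith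
    rw [h3] at h2
    have h4 : cross (x t) q / D t ≤ 1 := by
      calc cross (x t) q / D t = -1 / D t * -cross (x t) q := by ring
        _ ≤ 1 := h2
    rwa [div_le_one (hDpos t)] at h4
  have hm' := hasDerivAt_conormal hpos hr hr₁
  have hD' : ∀ t, HasDerivAt D 0 t := by
    intro t
    set j : ℝ → ℝ := fun s => cross (x s) (m t) with hj
    set k : ℝ → ℝ := fun s => cross (x t) (m s) with hk
    have hj' : HasDerivAt j 0 t := by
      refine (HasDerivAt.cross_const (hasDerivAt_smul_dir hr t) (m t)).congr_deriv ?_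
      rw [← smul_conormal hpos, cross_smul_left, cross_self, mul_zero]
    have hk' : HasDerivAt k 0 t := by
      refine (HasDerivAt.const_cross (x t) (hm' t)).congr_deriv ?_
      rw [cross_smul_right, cross_self, mul_zero]
    have hj0 : j t = 1 := hxm t
    have hk0 : k t = 1 := hxm t
    have hj1 : HasDerivAt (fun s => D t * j s) 0 t := by simpa using hj'.const_mul (D t)
    have hk1 : HasDerivAt (fun s => D t * (k s)⁻¹) 0 t := by
      simpa [hk0] using (hk'.inv (by rw [hk0]; exact one_ne_zero)).const_mul (D t)
    have hlow : ∀ s, D t * j s ≤ D s := fun s => by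
      have := hconj s _ (h.frontier_subset (hyf t))
      rwa [cross_smul_right] at this
    have hupp : ∀ᶠ s in 𝓝 t, D s ≤ D t * (k s)⁻¹ := by
      have : ∀ᶠ s in 𝓝 t, 0 < k s :=
        ContinuousAt.eventually_lt continuousAt_const hk'.continuousAt (by rw [hk0]; exact one_pos)
      filter_upwards [this] with s hs
      have := hconj t _ (h.frontier_subset (hyf s))
      rw [cross_smul_right] at this
      rwa [← div_eq_mul_inv, le_div_iff₀ hs]
    rw [hasDerivAt_iff_isLittleO] at hj1 hk1 ⊢
    have hsum := hj1.norm_left.add hk1.norm_left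
    refine (Asymptotics.IsBigO.of_bound 1 ?_).trans_isLittleO hsum
    filter_upwards [hupp] with s hs
    simp only [hj0, hk0, inv_one, mul_one, smul_zero, sub_zero, one_mul, Real.norm_eq_abs]
    rw [abs_of_nonneg (by positivity : 0 ≤ |D t * j s - D t| + |D t * (k s)⁻¹ - D t|)]
    have h1 := neg_abs_le (D t * j s - D t)
    have h2 := le_abs_self (D t * (k s)⁻¹ - D t)
    have h3 := abs_nonneg (D t * j s - D t)
    have h4 := abs_nonneg (D t * (k s)⁻¹ - D t)
    rw [abs_le]
    constructor <;> linarith [hlow s]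
  have hconst : ∀ t, D t = D 0 := fun t =>
    is_const_of_deriv_eq_zero (fun s => (hD' s).differentiableAt) (fun s => (hD' s).deriv) t 0
  exact ⟨D 0, hDpos 0, fun t => hconst t ▸ hyf t⟩

/-! ### Area in polar coordinates -/

lemma orthonormalBasisOneI_repr_polarCoord (p : ℝ × ℝ) :
    Complex.orthonormalBasisOneI.repr (Complex.polarCoord.symm p) = p.1 • dir p.2 := by
  apply plane_ext
  · simp [dir, -Complex.ofReal_cos, -Complex.ofReal_sin]
  · simp [dir, -Complex.ofReal_cos, -Complex.ofReal_sin]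

lemma lintegral_ofReal_mul_indicator {r : ℝ} (hr : 0 < r) :
    ∫⁻ ρ in Set.Ioi (0 : ℝ), ENNReal.ofReal ρ * (Set.Iic r).indicator 1 ρ =
      ENNReal.ofReal (r ^ 2 / 2) := by
  have h1 : ∀ ρ : ℝ, ENNReal.ofReal ρ * (Set.Iic r).indicator 1 ρ =
      (Set.Iic r).indicator (fun ρ => ENNReal.ofReal ρ) ρ := by
    intro ρ
    by_cases h : ρ ∈ Set.Iic r <;> simp [h]
  simp_rw [h1]
  rw [setLIntegral_indicator measurableSet_Iic, Set.inter_comm, Set.Ioi_inter_Iic,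
    ← ofReal_integral_eq_lintegral_ofReal, ← intervalIntegral.integral_of_le hr.le]
  · simp
  · exact (continuous_id.integrableOn_Icc).mono_set Set.Ioc_subset_Icc_self
  · exact (ae_restrict_iff' measurableSet_Ioc).2 (Eventually.of_forall fun x hx => hx.1.le)

lemma IsTable.volume_real {Ω : Set Plane} (h : IsTable Ω) :
    volume.real Ω = ∫ θ in (-Real.pi)..Real.pi, radial Ω θ ^ 2 / 2 := by
  have hcont : Continuous fun θ => radial Ω θ ^ 2 / 2 := by
    have := h.contDiff_radial.continuous
    fun_prop
  have hmeas : MeasurableSet Ω := h.isCompact.isClosed.measurableSet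
  set e := Complex.orthonormalBasisOneI.repr
  have hv : volume Ω = ∫⁻ z : ℂ, Ω.indicator 1 (e z) := by
    rw [← lintegral_indicator_one hmeas]
    exact (Complex.orthonormalBasisOneI.measurePreserving_repr.lintegral_comp
      (measurable_one.indicator hmeas)).symm
  have hval : volume Ω = ENNReal.ofReal (∫ θ in (-Real.pi)..Real.pi, radial Ω θ ^ 2 / 2) := by
    rw [hv, ← Complex.lintegral_comp_polarCoord_symm, polarCoord_target,
      Measure.volume_eq_prod, ← Measure.prod_restrict]
    have hae : ∀ p : ℝ × ℝ, p.1 ∈ Set.Ioi (0 : ℝ) →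
        ENNReal.ofReal p.1 • Ω.indicator (1 : Plane → ENNReal) (e (Complex.polarCoord.symm p)) =
        ENNReal.ofReal p.1 * (Set.Iic (radial Ω p.2)).indicator 1 p.1 := by
      intro p hp
      rw [orthonormalBasisOneI_repr_polarCoord, smul_eq_mul]
      congr 1
      by_cases hle : p.1 ≤ radial Ω p.2
      · rw [Set.indicator_of_mem ((h.smul_dir_mem_iff (le_of_lt hp) _).2 hle),
          Set.indicator_of_mem (Set.mem_Iic.2 hle)]; rfl
      · rw [Set.indicator_of_notMem (fun hm => hle ((h.smul_dir_mem_iff (le_of_lt hp) _).1 hm)),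
          Set.indicator_of_notMem (by simpa using hle)]
    rw [lintegral_prod_symm]
    · rw [intervalIntegral.integral_of_le (by linarith [Real.pi_pos]),
        integral_Ioc_eq_integral_Ioo, ofReal_integral_eq_lintegral_ofReal]
      · refine lintegral_congr fun θ => ?_
        rw [← lintegral_ofReal_mul_indicator (h.radial_pos θ)]
        exact setLIntegral_congr_fun measurableSet_Ioi fun ρ hρ => hae (ρ, θ) hρ
      · exact hcont.integrableOn_Icc.mono_set Set.Ioo_subset_Icc_self
      · exact Eventually.of_forall fun θ => by positivity
    · refine Measurable.aemeasurable (Measurable.smul (M := ENNReal) ?_ ?_)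
      · exact ENNReal.measurable_ofReal.comp measurable_fst
      refine (measurable_one.indicator hmeas).comp ?_
      simp_rw [e, orthonormalBasisOneI_repr_polarCoord]
      have : Continuous fun p : ℝ × ℝ => p.1 • dir p.2 :=
        continuous_fst.smul ((contDiff_dir (n := 0)).continuous.comp continuous_snd)
      exact this.measurable
  rw [Measure.real, hval, ENNReal.toReal_ofReal]
  exact intervalIntegral.integral_nonneg (by linarith [Real.pi_pos]) fun θ _ => by positivity

lemma IsRadonCurve.volume_real {Ω : Set Plane} (h : IsTable Ω) (hR : IsRadonCurve (frontier Ω)) :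
    volume.real Ω = ∫ θ in (0 : ℝ)..Real.pi, radial Ω θ ^ 2 := by
  have hcont : Continuous fun θ => radial Ω θ ^ 2 / 2 := by
    have := h.contDiff_radial.continuous
    fun_prop
  have hper : Function.Periodic (fun θ => radial Ω θ ^ 2 / 2) Real.pi := fun θ => by
    simp only [hR.radial_add_pi h]
  have h1 := hper.intervalIntegral_add_eq (-Real.pi) 0
  rw [neg_add_cancel, zero_add] at h1
  rw [h.volume_real, ← intervalIntegral.integral_add_adjacent_intervals
    (hcont.intervalIntegrable _ 0) (hcont.intervalIntegrable 0 _), h1,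
    ← intervalIntegral.integral_add (hcont.intervalIntegrable _ _) (hcont.intervalIntegrable _ _)]
  simp

/-! ### Frames of Radon curves -/

/-- A Radon curve `x` with its conjugate parametrization `y`, the advance `σ` of the parameter along
conjugate points, and a lift `Θ` of the polar angle of `x - y`. -/
structure RadonFrame (Ω : Set Plane) (A : ℝ) (x y : ℝ → Plane) (l m σ Θ : ℝ → ℝ) : Prop where
  A_pos : 0 < A
  hasDerivAt_x : ∀ t, HasDerivAt x (l t • y t) t
  hasDerivAt_y : ∀ t, HasDerivAt y (-m t • x t) t
  l_cont : Continuous l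
  m_cont : Continuous m
  l_pos : ∀ t, 0 < l t
  m_pos : ∀ t, 0 < m t
  l_add_pi : ∀ t, l (t + Real.pi) = l t
  m_add_pi : ∀ t, m (t + Real.pi) = m t
  cross_xy : ∀ t, cross (x t) (y t) = A
  x_add_pi : ∀ t, x (t + Real.pi) = -x t
  y_add_pi : ∀ t, y (t + Real.pi) = -y t
  x_mem : ∀ t, x t ∈ Ω
  cross_le : ∀ t, ∀ q ∈ Ω, cross q (y t) ≤ A
  polar_x : ∀ t, ∃ ρ : ℝ, 0 < ρ ∧ x t = ρ • dir t
  exists_smul : ∀ q ∈ Ω, ∃ s ∈ Set.Icc (0 : ℝ) 1, ∃ t, q = s • x t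
  σ_diff : Differentiable ℝ σ
  deriv_σ_mul_l : ∀ t, deriv σ t * l (σ t) = m t
  deriv_σ_mul_m : ∀ t, deriv σ t * m (σ t) = l t
  x_σ : ∀ t, x (σ t) = y t
  y_σ : ∀ t, y (σ t) = -x t
  lt_σ : ∀ t, t < σ t
  σ_lt : ∀ t, σ t < t + Real.pi
  σ_add_pi : ∀ t, σ (t + Real.pi) = σ t + Real.pi
  Θ_cont : Continuous Θ
  Θ_mono : StrictMono Θ
  Θ_add_pi : ∀ t, Θ (t + Real.pi) = Θ t + Real.pi
  polar : ∀ t, ∃ ρ : ℝ, 0 < ρ ∧ x t - y t = ρ • dir (Θ t)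
  area : volume.real Ω = A * ∫ t in (0 : ℝ)..Real.pi, l t

lemma deriv_add_pi {f f' : ℝ → ℝ} (hf : ∀ t, HasDerivAt f (f' t) t)
    (hp : ∀ t, f (t + Real.pi) = f t) (t : ℝ) : f' (t + Real.pi) = f' t := by
  have h1 := (hf (t + Real.pi)).comp_add_const t Real.pi
  simp_rw [hp] at h1
  exact h1.unique (hf t)

theorem IsRadonCurve.exists_radonFrame {Ω : Set Plane} (h : IsTable Ω)
    (hR : IsRadonCurve (frontier Ω)) :
    ∃ (A : ℝ) (x y : ℝ → Plane) (l m σ Θ : ℝ → ℝ), RadonFrame Ω A x y l m σ Θ := by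
  set r := radial Ω with hrdef
  have hC2 : ContDiff ℝ 2 r := h.contDiff_radial
  have hC1 : ContDiff ℝ 1 (deriv r) := by
    have : ContDiff ℝ (1 + 1) r := by simpa [one_add_one_eq_two] using hC2
    exact (contDiff_succ_iff_deriv.1 this).2.2
  set r₁ := deriv r
  set r₂ := deriv r₁
  have hr : ∀ t, HasDerivAt r (r₁ t) t := fun t => (hC2.differentiable (by norm_num) t).hasDerivAt
  have hr₁ : ∀ t, HasDerivAt r₁ (r₂ t) t := fun t =>
    (hC1.differentiable (by norm_num) t).hasDerivAt
  have c0 : Continuous r := hC2.continuous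
  have c1 : Continuous r₁ := hC1.continuous
  have c2 : Continuous r₂ := hC1.continuous_deriv (by norm_num)
  have hpos : ∀ t, 0 < r t := h.radial_pos
  have p0 : ∀ t, r (t + Real.pi) = r t := hR.radial_add_pi h
  have p1 : ∀ t, r₁ (t + Real.pi) = r₁ t := deriv_add_pi hr p0
  have p2 : ∀ t, r₂ (t + Real.pi) = r₂ t := deriv_add_pi hr₁ p1
  obtain ⟨A, hA, hyf⟩ := hR.exists_gauge_conormal h hr hr₁
  set x : ℝ → Plane := fun t => r t • dir t with hx
  set y : ℝ → Plane := fun t => A • conormal r r₁ t with hy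
  set l : ℝ → ℝ := fun t => r t ^ 2 / A with hl
  set κ : ℝ → ℝ := fun t => (1 / r t - (r₂ t * r t - 2 * r₁ t ^ 2) / r t ^ 3) / r t with hκ
  set m : ℝ → ℝ := fun t => A * κ t with hm
  have hx' : ∀ t, HasDerivAt x (l t • y t) t := fun t => by
    refine (hasDerivAt_smul_dir hr t).congr_deriv ?_
    rw [← smul_conormal hpos, hl, hy, smul_smul, div_mul_cancel₀ _ hA.ne']
  have hy' : ∀ t, HasDerivAt y (-m t • x t) t := fun t => by
    refine ((hasDerivAt_conormal hpos hr hr₁ t).const_smul A).congr_deriv ?_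
    rw [smul_smul, hm]
    congr 1
    ring
  have hxy : ∀ t, cross (x t) (y t) = A := fun t => by
    rw [hy, cross_smul_right, cross_conormal hpos, mul_one]
  have hxf : ∀ t, x t ∈ frontier Ω := fun t => (h.smul_dir_mem_frontier_iff (hpos t).le t).2 rfl
  have lpos : ∀ t, 0 < l t := fun t => div_pos (pow_pos (hpos t) 2) hA
  have hxπ : ∀ t, x (t + Real.pi) = -x t := fun t => by
    simp only [hx, p0, dir_add_pi, smul_neg]
  have hcπ : ∀ t, conormal r r₁ (t + Real.pi) = -conormal r r₁ t := fun t => by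
    simp only [conormal, p0, p1, dir_add_pi, add_right_comm t Real.pi (Real.pi / 2), smul_neg,
      neg_add]
  have hyπ : ∀ t, y (t + Real.pi) = -y t := fun t => by
    simp only [hy, hcπ, smul_neg]
  have hsup : ∀ t, Supports Ω (x t) (conormal r r₁ t) := h.supports_conormal hr
  have hcle : ∀ t, ∀ q ∈ Ω, cross q (y t) ≤ A := fun t q hq => by
    rw [hy, cross_smul_right]
    nlinarith [(hsup t).2 q hq]
  set σ : ℝ → ℝ := fun t => t + Real.pi / 2 + Real.arctan (-r₁ t / r t) with hσ
  have yne : ∀ t, y t ≠ 0 := fun t => smul_ne_zero hA.ne' (hsup t).ne_zero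
  have hypolar : ∀ t, ∃ ρ : ℝ, 0 ≤ ρ ∧ y t = ρ • dir (σ t) := by
    intro t
    have e := smul_dir_add_smul_dir (c := -r₁ t) (hpos t) (t + Real.pi / 2)
    have e2 : y t = (A / r t ^ 2) • (r t • dir (t + Real.pi / 2) +
        (-r₁ t) • dir (t + Real.pi / 2 + Real.pi / 2)) := by
      have h0 := (hpos t).ne'
      rw [add_assoc t, add_halves, dir_add_pi]
      simp only [hy, conormal, smul_add, smul_smul, smul_neg, neg_smul, neg_neg]
      rw [add_comm]
      congr 2
      · field_simp
      · field_simp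
    refine ⟨A / r t ^ 2 * Real.sqrt ((-r₁ t) ^ 2 + r t ^ 2), ?_, ?_⟩
    · have := hpos t
      positivity
    · rw [e2, e, smul_smul]
  have hxσ : ∀ t, x (σ t) = y t := by
    intro t
    obtain ⟨ρ, hρ, hyρ⟩ := hypolar t
    have := hyf t
    change y t ∈ frontier Ω at this
    rw [hyρ, h.smul_dir_mem_frontier_iff hρ] at this
    rw [hyρ, this]
  have hyσ : ∀ t, y (σ t) = -x t := by
    intro t
    have h1 : BirkhoffOrthogonal (frontier Ω) (x t) (y t) :=
      (h.isTangentVector_iff (hxf t) (hsup t) _).2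
        ⟨yne t, by rw [hy, cross_smul_left, cross_self, mul_zero]⟩
    have h2 := hR.symm _ (hxf t) _ (hyf t) h1
    change IsTangentVector (frontier Ω) (y t) (x t) at h2
    rw [← hxσ, h.isTangentVector_iff (hxf _) (hsup _)] at h2
    obtain ⟨k, hk⟩ := exists_smul_of_cross_eq_zero (v := y (σ t)) h2.1
      (by rw [hy, cross_smul_left, cross_swap, h2.2]; simp)
    have h3 := hxy (σ t)
    rw [hxσ, hk, cross_smul_right, cross_swap, hxy] at h3
    have h4 : k = -1 := by
      have : k * A = -1 * A := by linarith
      exact mul_right_cancel₀ hA.ne' this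
    rw [hk, h4, neg_one_smul]
  have σdiff : Differentiable ℝ σ := by
    intro t
    have h1 := (hr₁ t).differentiableAt
    have h2 := (hr t).differentiableAt
    have h3 := (hpos t).ne'
    exact (differentiableAt_id.add_const _).add ((h1.neg.div h2 h3).arctan)
  have σlow : ∀ t, t < σ t := fun t => by
    have := Real.neg_pi_div_two_lt_arctan (-r₁ t / r t)
    simp only [hσ]; linarith
  have σupp : ∀ t, σ t < t + Real.pi := fun t => by
    have := Real.arctan_lt_pi_div_two (-r₁ t / r t)
    simp only [hσ]; linarith
  have σπ : ∀ t, σ (t + Real.pi) = σ t + Real.pi := fun t => by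
    simp only [hσ, p0, p1]; ring
  have σ1 : ∀ t, deriv σ t * l (σ t) = m t := by
    intro t
    have h1 := (hx' (σ t)).scomp t (σdiff t).hasDerivAt
    have e : x ∘ σ = y := funext hxσ
    rw [e, hyσ] at h1
    have h2 := congrArg (fun p => cross p (y t)) (h1.unique (hy' t))
    simp only [cross_smul_left, cross_neg_left, hxy] at h2
    have : (deriv σ t * l (σ t)) * A = m t * A := by linarith
    exact mul_right_cancel₀ hA.ne' this
  have σ2 : ∀ t, deriv σ t * m (σ t) = l t := by
    intro t
    have h1 := (hy' (σ t)).scomp t (σdiff t).hasDerivAt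
    have e : y ∘ σ = fun s => -x s := funext hyσ
    rw [e, hxσ] at h1
    have h2 := congrArg (fun p => cross (x t) p) (h1.unique (hx' t).neg)
    simp only [cross_smul_right, cross_neg_right, hxy] at h2
    have : (deriv σ t * m (σ t)) * A = l t * A := by linarith
    exact mul_right_cancel₀ hA.ne' this
  have lcont : Continuous l := by simp only [hl]; fun_prop
  have mcont : Continuous m := by
    have h1 : ∀ t, r t ≠ 0 := fun t => (hpos t).ne'
    simp only [hm, hκ]
    exact continuous_const.mul (((continuous_const.div c0 h1).sub
      (((c2.mul c0).sub (continuous_const.mul (c1.pow 2))).div (c0.pow 3)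
        (fun t => pow_ne_zero 3 (h1 t)))).div c0 h1)
  have mne : ∀ t, m t ≠ 0 := fun t h0 => by
    have h1 := σ1 t
    rw [h0] at h1
    have h2 := σ2 t
    rw [(mul_eq_zero.1 h1).resolve_right (lpos _).ne', zero_mul] at h2
    exact (lpos t).ne h2
  have mpos : ∀ t, 0 < m t := by
    obtain ⟨t₁, -, ht₁⟩ := exists_deriv_eq_slope σ (a := 0) (b := Real.pi) Real.pi_pos
      σdiff.continuous.continuousOn σdiff.differentiableOn
    have e := σπ 0
    rw [zero_add] at e
    rw [e, add_sub_cancel_left, sub_zero, div_self Real.pi_ne_zero] at ht₁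
    have hm1 : 0 < m t₁ := by
      rw [← σ1, ht₁, one_mul]; exact lpos _
    intro t
    by_contra hneg
    push Not at hneg
    obtain ⟨s, hs⟩ := mem_range_of_exists_le_of_exists_ge mcont ⟨t, hneg⟩ ⟨t₁, hm1.le⟩
    exact mne s hs
  set c : ℝ → ℝ := fun t => r t - A * r₁ t / r t ^ 2 with hc
  set Θ : ℝ → ℝ := fun t => t - Real.pi / 2 + Real.arctan (c t / (A / r t)) with hΘ
  have hpolar : ∀ t, ∃ ρ : ℝ, 0 < ρ ∧ x t - y t = ρ • dir (Θ t) := by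
    intro t
    have hd : 0 < A / r t := div_pos hA (hpos t)
    refine ⟨Real.sqrt (c t ^ 2 + (A / r t) ^ 2), by positivity, ?_⟩
    have e := smul_dir_add_smul_dir (c := c t) hd (t - Real.pi / 2)
    rw [hΘ, ← e, sub_add_cancel]
    have e3 : dir (t - Real.pi / 2) = -dir (t + Real.pi / 2) := by
      rw [← dir_add_pi]
      have e4 := dir_add_two_pi (t - Real.pi / 2)
      rw [← e4]
      congr 1
      ring
    rw [e3]
    have h0 := (hpos t).ne'
    apply plane_ext
    · simp [hx, hy, hc, conormal]
      field_simp
      ring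
    · simp [hx, hy, hc, conormal]
      field_simp
      ring
  have Θdiff : Differentiable ℝ Θ := by
    intro t
    have h1 := (hr₁ t).differentiableAt
    have h2 := (hr t).differentiableAt
    have h3 := (hpos t).ne'
    have h4 : A / r t ≠ 0 := div_ne_zero hA.ne' h3
    have hcd : DifferentiableAt ℝ c t :=
      h2.sub ((h1.const_mul A).div (h2.pow 2) (pow_ne_zero 2 h3))
    have hdd : DifferentiableAt ℝ (fun t => A / r t) t := (differentiableAt_const A).div h2 h3
    exact (differentiableAt_id.sub_const _).add ((hcd.div hdd h4).arctan)
  have Θpos : ∀ t, 0 < deriv Θ t := by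
    intro t
    have hv : HasDerivAt (fun s => x s - y s) (l t • y t - -m t • x t) t := (hx' t).sub (hy' t)
    have hdΘ : HasDerivAt (fun s => dir (Θ s)) (deriv Θ t • dir (Θ t + Real.pi / 2)) t :=
      (hasDerivAt_dir (Θ t)).scomp t (Θdiff t).hasDerivAt
    have hz : (fun s => cross (x s - y s) (dir (Θ s))) = fun _ => 0 := by
      funext s
      obtain ⟨ρ, -, e⟩ := hpolar s
      rw [e, cross_smul_left, cross_self, mul_zero]
    have h1 := HasDerivAt.cross hv hdΘ
    rw [hz] at h1
    have h2 := h1.unique (hasDerivAt_const t 0)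
    obtain ⟨ρ, hρ, e⟩ := hpolar t
    have h3 : dir (Θ t) = ρ⁻¹ • (x t - y t) := by
      rw [e, smul_smul, inv_mul_cancel₀ hρ.ne', one_smul]
    have h4 : cross (x t - y t) (deriv Θ t • dir (Θ t + Real.pi / 2)) = deriv Θ t * ρ := by
      rw [e, cross_smul_left, cross_smul_right, cross_dir]
      simp; ring
    rw [h4, h3] at h2
    simp only [cross_smul_right, cross_sub_left, cross_sub_right, cross_smul_left, cross_self,
      cross_swap (y t) (x t), hxy] at h2
    have h5 : deriv Θ t * ρ = ρ⁻¹ * ((l t + m t) * A) := by linarith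
    have h6 : 0 < deriv Θ t * ρ := by
      rw [h5]
      have := lpos t
      have := mpos t
      positivity
    exact (pos_iff_pos_of_mul_pos h6).2 hρ
  refine ⟨A, x, y, l, m, σ, Θ, ?_⟩
  exact
  { A_pos := hA
    hasDerivAt_x := hx'
    hasDerivAt_y := hy'
    l_cont := lcont
    m_cont := mcont
    l_pos := lpos
    m_pos := mpos
    l_add_pi := fun t => by simp only [hl, p0]
    m_add_pi := fun t => by simp only [hm, hκ, p0, p1, p2]
    cross_xy := hxy
    x_add_pi := hxπ
    y_add_pi := hyπ
    x_mem := fun t => h.frontier_subset (hxf t)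
    cross_le := hcle
    polar_x := fun t => ⟨r t, hpos t, rfl⟩
    exists_smul := fun q hq => by
      obtain ⟨t, ht⟩ := exists_eq_norm_smul_dir q
      rw [ht, h.smul_dir_mem_iff (norm_nonneg _)] at hq
      refine ⟨‖q‖ / r t, ⟨by have := hpos t; positivity, (div_le_one (hpos t)).2 hq⟩, t, ?_⟩
      rw [hx, smul_smul, div_mul_cancel₀ _ (hpos t).ne', ← ht]
    σ_diff := σdiff
    deriv_σ_mul_l := σ1
    deriv_σ_mul_m := σ2
    x_σ := hxσ
    y_σ := hyσ
    lt_σ := σlow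
    σ_lt := σupp
    σ_add_pi := σπ
    Θ_cont := Θdiff.continuous
    Θ_mono := strictMono_of_deriv_pos Θpos
    Θ_add_pi := fun t => by simp only [hΘ, hc, p0, p1]; ring
    polar := hpolar
    area := by
      rw [hR.volume_real h, hl, intervalIntegral.integral_div, mul_div_cancel₀ _ hA.ne'] }

/-! ### A monotonicity criterion -/

lemma le_of_forall_local {g : ℝ → ℝ} {a b : ℝ} (hab : a ≤ b)
    (hright : ∀ t ∈ Set.Ico a b, ∀ ε > 0, ∀ᶠ s in 𝓝[>] t, g t - ε * (s - t) ≤ g s)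
    (hleft : ∀ t ∈ Set.Ioc a b, ∀ ε > 0, ∀ᶠ s in 𝓝[<] t, g s - ε ≤ g t) : g a ≤ g b := by
  suffices H : ∀ ε > 0, g a - ε * (b - a) ≤ g b by
    refine le_of_forall_pos_le_add fun η hη => ?_
    have hpos : 0 < b - a + 1 := by linarith
    have := H (η / (b - a + 1)) (by positivity)
    have h2 : η / (b - a + 1) * (b - a) ≤ η := by
      rw [div_mul_eq_mul_div, div_le_iff₀ hpos]; nlinarith
    linarith
  intro ε hε
  set T : Set ℝ := {t | t ∈ Set.Icc a b ∧ g a - ε * (t - a) ≤ g t} with hT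
  have haT : a ∈ T := ⟨⟨le_rfl, hab⟩, by simp⟩
  have hbdd : BddAbove T := ⟨b, fun t ht => ht.1.2⟩
  set c := sSup T with hc
  have hac : a ≤ c := le_csSup hbdd haT
  have hcb : c ≤ b := csSup_le ⟨a, haT⟩ fun t ht => ht.1.2
  have hcT : c ∈ T := by
    by_contra hcT
    have hac' : a < c := lt_of_le_of_ne hac fun e => hcT (e ▸ haT)
    have hfreq : ∃ᶠ s in 𝓝[<] c, s ∈ T := by
      rw [Filter.frequently_iff]
      intro U hU
      obtain ⟨d, hd, hdU⟩ := (mem_nhdsLT_iff_exists_Ioo_subset' hac').1 hU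
      obtain ⟨s, hsT, hds⟩ := exists_lt_of_lt_csSup ⟨a, haT⟩ (hd : d < sSup T)
      have hsc : s ≤ c := le_csSup hbdd hsT
      have hsc' : s < c := lt_of_le_of_ne hsc fun e => hcT (e ▸ hsT)
      exact ⟨s, hdU ⟨hds, hsc'⟩, hsT⟩
    refine hcT ⟨⟨hac, hcb⟩, le_of_forall_pos_le_add fun η hη => ?_⟩
    obtain ⟨s, hsT, hs, hsc⟩ := (hfreq.and_eventually
      ((hleft c ⟨hac', hcb⟩ η hη).and self_mem_nhdsWithin)).exists
    have h1 := hsT.2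
    have h2 : s < c := hsc
    nlinarith
  rcases hcb.eq_or_lt with e | hlt
  · rw [← e]; exact hcT.2
  · obtain ⟨s, ⟨hs, hsc⟩, hsb⟩ := ((hright c ⟨hac, hlt⟩ ε hε).and
      (self_mem_nhdsWithin : Set.Ioi c ∈ 𝓝[>] c)).and
      ((eventually_lt_nhds hlt).filter_mono nhdsWithin_le_nhds) |>.exists
    have h2 : c < s := hsc
    have h3 := hcT.2
    exact absurd (le_csSup hbdd (a := s) ⟨⟨by linarith, hsb.le⟩, by nlinarith⟩) (not_le.2 h2)

lemma le_of_forall_local' {g : ℝ → ℝ} {a b : ℝ} (hab : b ≤ a)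
    (hleft : ∀ t ∈ Set.Ioc b a, ∀ ε > 0, ∀ᶠ s in 𝓝[<] t, g t - ε * (t - s) ≤ g s)
    (hright : ∀ t ∈ Set.Ico b a, ∀ ε > 0, ∀ᶠ s in 𝓝[>] t, g s - ε ≤ g t) : g a ≤ g b := by
  have := le_of_forall_local (g := fun t => g (-t)) (a := -a) (b := -b) (neg_le_neg hab)
    (fun t ht ε hε => by
      have h1 := hleft (-t) ⟨by linarith [ht.2], by linarith [ht.1]⟩ ε hε
      filter_upwards [(tendsto_neg_nhdsGT (a := t)).eventually h1] with s hs
      have e : -t - -s = s - t := by ring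
      rwa [e] at hs)
    (fun t ht ε hε => by
      have h1 := hright (-t) ⟨by linarith [ht.2], by linarith [ht.1]⟩ ε hε
      exact (tendsto_neg_nhdsLT (a := t)).eventually h1)
  simpa using this

/-! ### The calibration inequality -/

namespace RadonFrame

variable {Ω : Set Plane} {A : ℝ} {x y : ℝ → Plane} {l m σ Θ : ℝ → ℝ}

lemma cross_yx (F : RadonFrame Ω A x y l m σ Θ) (t : ℝ) : cross (y t) (x t) = -A := by
  rw [cross_swap, F.cross_xy]

lemma deriv_σ_pos (F : RadonFrame Ω A x y l m σ Θ) (t : ℝ) : 0 < deriv σ t :=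
  (pos_iff_pos_of_mul_pos (by rw [F.deriv_σ_mul_l]; exact F.m_pos t)).2 (F.l_pos (σ t))

lemma σ_mono (F : RadonFrame Ω A x y l m σ Θ) : StrictMono σ :=
  strictMono_of_deriv_pos F.deriv_σ_pos

lemma polar_σ (F : RadonFrame Ω A x y l m σ Θ) (t : ℝ) :
    ∃ ρ : ℝ, 0 < ρ ∧ x t + y t = ρ • dir (Θ (σ t)) := by
  obtain ⟨ρ, hρ, e⟩ := F.polar (σ t)
  rw [F.x_σ, F.y_σ, sub_neg_eq_add, add_comm] at e
  exact ⟨ρ, hρ, e⟩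

lemma admissible (F : RadonFrame Ω A x y l m σ Θ) {a b : ℝ} (h1 : a < b)
    (h2 : b < a + Real.pi) : Admissible (Θ a) (Θ b) :=
  ⟨F.Θ_mono h1, by rw [← F.Θ_add_pi]; exact F.Θ_mono h2⟩

lemma cross_nonneg_of_polar (F : RadonFrame Ω A x y l m σ Θ) {a b : ℝ} {v w : Plane}
    (hv : ∃ ρ : ℝ, 0 < ρ ∧ v = ρ • dir (Θ a)) (hw : ∃ ρ : ℝ, 0 < ρ ∧ w = ρ • dir (Θ b))
    (h1 : a ≤ b) (h2 : b ≤ a + Real.pi) : 0 ≤ cross v w := by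
  obtain ⟨ρ, hρ, rfl⟩ := hv
  obtain ⟨ρ', hρ', rfl⟩ := hw
  rw [cross_smul_left, cross_smul_right, cross_dir]
  have e1 := F.Θ_mono.monotone h1
  have e2 := F.Θ_mono.monotone h2
  rw [F.Θ_add_pi] at e2
  have := Real.sin_nonneg_of_nonneg_of_le_pi (sub_nonneg.2 e1) (by linarith)
  positivity

/-- The optimal triangle in terms of the vertices of the invariant curve. -/
lemma exists_optimal (F : RadonFrame Ω A x y l m σ Θ) (h : IsTable Ω) {a b : ℝ}
    (h1 : a < σ b) (h2 : σ b < a + Real.pi) :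
    0 < cross (x a - y a) (x b + y b) ∧ ∃ s t : ℝ, 0 < s ∧ 0 < t ∧
      s • (x a - y a) + t • (x b + y b) ∈ Ω ∧
      (∀ s' t' : ℝ, s' • (x a - y a) + t' • (x b + y b) ∈ Ω → s' / (2 * s) + t' / (2 * t) ≤ 1) ∧
      generatingFunction Ω (Θ a) (Θ (σ b)) = 2 * s * t * cross (x a - y a) (x b + y b) := by
  have hadm := F.admissible h1 h2
  obtain ⟨s, t, hs, ht, hmem, hle, hS⟩ := h.exists_optimal hadm
  obtain ⟨ρ, hρ, e⟩ := F.polar a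
  obtain ⟨ρ', hρ', e'⟩ := F.polar_σ b
  rw [e, e', cross_smul_left, cross_smul_right, cross_dir]
  have hsin := Real.sin_pos_of_pos_of_lt_pi (x := Θ (σ b) - Θ a) (by linarith [hadm.1])
    (by linarith [hadm.2])
  refine ⟨by positivity, s / ρ, t / ρ', by positivity, by positivity, ?_, fun s' t' hst => ?_, ?_⟩
  · rwa [smul_smul, smul_smul, div_mul_cancel₀ _ hρ.ne', div_mul_cancel₀ _ hρ'.ne']
  · rw [smul_smul, smul_smul] at hst
    have := hle _ _ hst
    calc s' / (2 * (s / ρ)) + t' / (2 * (t / ρ')) = s' * ρ / (2 * s) + t' * ρ' / (2 * t) := by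
          field_simp
      _ ≤ 1 := this
  · rw [hS]; field_simp

lemma cross_vw (F : RadonFrame Ω A x y l m σ Θ) (t : ℝ) :
    cross (x t - y t) (x t + y t) = 2 * A := by
  simp only [cross_sub_left, cross_add_right, cross_self, F.cross_xy, F.cross_yx]; ring

lemma sub_mul_sub_nonpos {σ τ f : ℝ} (hσ : 0 < σ) (hτ : 0 < τ)
    (h1 : 1 / σ + (1 + f) / τ ≤ 1) (h2 : (1 - f) * σ + τ ≤ 4) (hf : f ≤ 1) :
    (τ - 2) * (τ - 2 - 2 * f) ≤ 0 := by
  have e1 : τ + (1 + f) * σ ≤ σ * τ := by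
    have := mul_le_mul_of_nonneg_right h1 (by positivity : 0 ≤ σ * τ)
    have e : (1 / σ + (1 + f) / τ) * (σ * τ) = τ + (1 + f) * σ := by field_simp
    linarith
  have e2 : 0 < τ - 1 - f := by
    have : 0 < σ * (τ - 1 - f) := by nlinarith
    exact (pos_iff_pos_of_mul_pos this).1 hσ
  have e3 : (1 - f) * (σ * (τ - 1 - f)) ≤ (4 - τ) * (τ - 1 - f) := by nlinarith
  have e4 : (1 - f) * τ ≤ (1 - f) * (σ * (τ - 1 - f)) :=
    mul_le_mul_of_nonneg_left (by nlinarith) (by linarith)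
  nlinarith

lemma optimal_height (F : RadonFrame Ω A x y l m σ Θ) {a b s t : ℝ}
    (hc : 0 < cross (x a - y a) (x b + y b)) (hs : 0 < s) (ht : 0 < t)
    (hmem : s • (x a - y a) + t • (x b + y b) ∈ Ω)
    (hle : ∀ s' t' : ℝ, s' • (x a - y a) + t' • (x b + y b) ∈ Ω →
      s' / (2 * s) + t' / (2 * t) ≤ 1) :
    (0 ≤ cross (x a - y a) (x b - y b) → 1 / 2 ≤ t) ∧
      (cross (x a - y a) (x b - y b) ≤ 0 → t ≤ 1 / 2) := by
  set v := x a - y a with hv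
  set w := x b + y b with hw
  set c := cross v w with hcd
  set f := cross v (x b - y b) / c with hf
  set e := 2 * A / c with he
  have hA := F.A_pos
  have hepos : 0 < e := by positivity
  have hvb : x b - y b = e • v + f • w := by
    have := eq_smul_add_smul hc.ne' (x b - y b)
    rwa [F.cross_vw] at this
  have hxb : x b = (e / 2) • v + ((1 + f) / 2) • w := by
    have e1 : x b = (1 / 2 : ℝ) • (x b - y b) + (1 / 2 : ℝ) • w := by
      rw [hw]; module
    rw [e1, hvb]; module
  have hyb : y b = ((1 - f) / 2) • w - (e / 2) • v := by
    have e1 : y b = (1 / 2 : ℝ) • w - (1 / 2 : ℝ) • (x b - y b) := by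
      rw [hw]; module
    rw [e1, hvb]; module
  have h1 := hle _ _ (hxb ▸ F.x_mem b)
  have h2 := F.cross_le b _ hmem
  rw [hyb] at h2
  simp only [cross_add_left, cross_sub_right, cross_smul_left, cross_smul_right, cross_self,
    cross_swap w v, ← hcd] at h2
  have hec : e * c = 2 * A := div_mul_cancel₀ _ hc.ne'
  have h3 : (1 - f) * (4 * s / e) + 4 * t ≤ 4 := by
    have : c * ((1 - f) * s + t * e) ≤ c * e := by nlinarith
    have := le_of_mul_le_mul_left this hc
    have : ((1 - f) * s + t * e) / e ≤ 1 := (div_le_one hepos).2 this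
    have e3 : (1 - f) * (4 * s / e) + 4 * t = 4 * (((1 - f) * s + t * e) / e) := by field_simp
    rw [e3]; linarith
  have h4 : 1 / (4 * s / e) + (1 + f) / (4 * t) ≤ 1 := by
    calc 1 / (4 * s / e) + (1 + f) / (4 * t) = e / 2 / (2 * s) + (1 + f) / 2 / (2 * t) := by
          field_simp; ring
      _ ≤ 1 := h1
  rcases le_or_gt f 1 with hf1 | hf1
  · have key := sub_mul_sub_nonpos (by positivity) (by positivity) h4 h3 hf1
    constructor
    · intro h0
      have hf0 : 0 ≤ f := div_nonneg h0 hc.le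
      by_contra hlt
      push Not at hlt
      nlinarith
    · intro h0
      have hf0 : f ≤ 0 := div_nonpos_of_nonpos_of_nonneg h0 hc.le
      by_contra hlt
      push Not at hlt
      nlinarith
  · constructor
    · intro _
      by_contra hlt
      push Not at hlt
      have : 1 < (1 + f) / (4 * t) := by rw [lt_div_iff₀ (by positivity)]; linarith
      have : 0 < 1 / (4 * s / e) := by positivity
      linarith
    · intro h0
      have hf0 : f ≤ 0 := div_nonpos_of_nonpos_of_nonneg h0 hc.le
      linarith

lemma cross_v_pos (F : RadonFrame Ω A x y l m σ Θ) {a b : ℝ} (h1 : a ≤ b)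
    (h2 : b ≤ a + Real.pi) : 0 ≤ cross (x a - y a) (x b - y b) :=
  F.cross_nonneg_of_polar (F.polar a) (F.polar b) h1 h2

lemma cross_w_pos (F : RadonFrame Ω A x y l m σ Θ) {a b : ℝ} (h1 : a ≤ b)
    (h2 : b ≤ a + Real.pi) : 0 ≤ cross (x a + y a) (x b + y b) :=
  F.cross_nonneg_of_polar (F.polar_σ a) (F.polar_σ b) (F.σ_mono.monotone h1)
    (by rw [← F.σ_add_pi]; exact F.σ_mono.monotone h2)

/-- The lower bound for the increment of the generating function, up to second order. -/
def increment (x y : ℝ → Plane) (a b b' : ℝ) : ℝ :=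
  1 / 2 * cross (x b + y b) (x b' + y b') * cross (x a - y a) (x b + y b) /
    cross (x a - y a) (x b' + y b')

lemma generatingFunction_increment (F : RadonFrame Ω A x y l m σ Θ) (h : IsTable Ω) {a b b' : ℝ}
    (h1 : a < σ b) (h2 : σ b < a + Real.pi) (h1' : a < σ b') (h2' : σ b' < a + Real.pi)
    (hb : a ≤ b ∧ b ≤ b' ∨ b' ≤ b ∧ b ≤ a) :
    generatingFunction Ω (Θ a) (Θ (σ b)) + increment x y a b b' ≤
      generatingFunction Ω (Θ a) (Θ (σ b')) := by
  obtain ⟨hc, s, t, hs, ht, hmem, hle, hS⟩ := F.exists_optimal h h1 h2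
  obtain ⟨hc', s', t', hs', ht', hmem', hle', hS'⟩ := F.exists_optimal h h1' h2'
  obtain ⟨hup, hlow⟩ := F.optimal_height hc hs ht hmem hle
  have hlt1 := F.lt_σ b
  have hlt2 := F.σ_lt b
  have hlt1' := F.lt_σ b'
  have hlt2' := F.σ_lt b'
  have hsign : (1 / 2 ≤ t ∧ 0 ≤ cross (x b + y b) (x b' + y b')) ∨
      (t ≤ 1 / 2 ∧ cross (x b + y b) (x b' + y b') ≤ 0) := by
    rcases hb with ⟨hb1, hb2⟩ | ⟨hb1, hb2⟩
    · exact Or.inl ⟨hup (F.cross_v_pos hb1 (by linarith)), F.cross_w_pos hb2 (by linarith)⟩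
    · refine Or.inr ⟨hlow ?_, ?_⟩
      · rw [cross_swap]
        linarith [F.cross_v_pos hb2 (by linarith)]
      · rw [cross_swap]
        linarith [F.cross_w_pos hb1 (by linarith)]
  rw [hS, hS']
  unfold increment
  set v := x a - y a
  set w := x b + y b
  set w' := x b' + y b'
  set c := cross v w
  set c' := cross v w'
  set d := cross w w'
  set p := s • v + t • w with hp
  have hp1 : cross v p = t * c := by
    simp [hp, cross_add_right, cross_smul_right, c]
  have hp2 : cross p w' = s * c' + t * d := by
    simp [hp, cross_add_left, cross_smul_left, c', d]
  have hdec := eq_smul_add_smul hc'.ne' p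
  have hle2 := hle' _ _ (hdec ▸ hmem)
  have hst := mul_le_of_div_add_div_le_one hs' ht' (by rw [hp1]; positivity) hle2
  rw [hp1, hp2] at hst
  have e1 : 2 * ((s * c' + t * d) / c' * (t * c / c')) * c' = 2 * s * t * c + 2 * t ^ 2 * d * c / c' := by
    field_simp
  have e2 : 1 / 2 * d * c / c' ≤ 2 * t ^ 2 * d * c / c' := by
    have : 1 / 2 * d ≤ 2 * t ^ 2 * d := by
      rcases hsign with ⟨ht1, hd⟩ | ⟨ht1, hd⟩
      · have : 1 / 2 ≤ 2 * t ^ 2 := by nlinarith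
        exact mul_le_mul_of_nonneg_right this hd
      · have : 2 * t ^ 2 ≤ 1 / 2 := by nlinarith
        exact mul_le_mul_of_nonpos_right this hd
    gcongr
  have e3 := mul_le_mul_of_nonneg_right hst hc'.le
  calc 2 * s * t * c + 1 / 2 * d * c / c' ≤ 2 * s * t * c + 2 * t ^ 2 * d * c / c' := by linarith
    _ = 2 * ((s * c' + t * d) / c' * (t * c / c') * c') := by rw [← e1]; ring
    _ ≤ 2 * (s' * t' * c') := by linarith
    _ = _ := by ring

/-- On the invariant curve the generating function is constant. -/
lemma generatingFunction_σ (F : RadonFrame Ω A x y l m σ Θ) (h : IsTable Ω) (a : ℝ) :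
    generatingFunction Ω (Θ a) (Θ (σ a)) = A := by
  obtain ⟨hc, s, t, hs, ht, hmem, hle, hS⟩ := F.exists_optimal h (F.lt_σ a) (F.σ_lt a)
  obtain ⟨hup, hlow⟩ := F.optimal_height hc hs ht hmem hle
  have htt : t = 1 / 2 := le_antisymm (hlow (by simp)) (hup (by simp))
  have hA := F.A_pos
  have h1 := hle (1 / 2) (1 / 2) (by
    have : (1 / 2 : ℝ) • (x a - y a) + (1 / 2 : ℝ) • (x a + y a) = x a := by module
    rw [this]; exact F.x_mem a)
  have h2 := F.cross_le a _ hmem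
  simp only [cross_add_left, cross_sub_left, cross_smul_left, cross_self, F.cross_xy] at h2
  have h3 : s + t ≤ 1 := by nlinarith
  have h4 : 1 / 2 ≤ s := by
    rw [htt] at h1
    have e : (1 / 2 : ℝ) / (2 * s) ≤ 1 / 2 := by linarith
    rw [div_le_iff₀ (by positivity)] at e
    linarith
  have hss : s = 1 / 2 := by linarith
  rw [hS, F.cross_vw, hss, htt]; ring

/-- The area swept by the invariant curve. -/
def sweptArea (A : ℝ) (l m : ℝ → ℝ) (t : ℝ) : ℝ := ∫ s in (0 : ℝ)..t, A / 2 * (l s + m s)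

lemma hasDerivAt_sweptArea (F : RadonFrame Ω A x y l m σ Θ) (t : ℝ) :
    HasDerivAt (sweptArea A l m) (A / 2 * (l t + m t)) t := by
  have : Continuous fun s => A / 2 * (l s + m s) :=
    continuous_const.mul (F.l_cont.add F.m_cont)
  exact this.integral_hasStrictDerivAt 0 t |>.hasDerivAt

lemma x_cont (F : RadonFrame Ω A x y l m σ Θ) : Continuous x :=
  continuous_iff_continuousAt.2 fun t => (F.hasDerivAt_x t).continuousAt

lemma y_cont (F : RadonFrame Ω A x y l m σ Θ) : Continuous y :=
  continuous_iff_continuousAt.2 fun t => (F.hasDerivAt_y t).continuousAt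

lemma increment_right (F : RadonFrame Ω A x y l m σ Θ) {a t : ℝ}
    (hc : 0 < cross (x a - y a) (x t + y t)) {ε : ℝ} (hε : 0 < ε) :
    ∀ᶠ s in 𝓝 t, |increment x y a t s - (sweptArea A l m s - sweptArea A l m t)| ≤
      ε * |s - t| := by
  have hw : HasDerivAt (fun s => x s + y s) (l t • y t + -m t • x t) t :=
    (F.hasDerivAt_x t).add (F.hasDerivAt_y t)
  have h1 := HasDerivAt.const_cross (x t + y t) hw
  have h2 := HasDerivAt.const_cross (x a - y a) hw
  have h3 := ((h1.const_mul (1 / 2)).mul_const (cross (x a - y a) (x t + y t))).div h2 hc.ne'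
  have h4 := h3.sub ((F.hasDerivAt_sweptArea t).sub_const (sweptArea A l m t))
  have h5 : HasDerivAt (fun s => increment x y a t s -
      (sweptArea A l m s - sweptArea A l m t)) 0 t := by
    refine h4.congr_deriv ?_
    have e : cross (x t + y t) (l t • y t + -m t • x t) = A * (l t + m t) := by
      simp only [cross_add_left, cross_add_right, cross_smul_right, cross_self, F.cross_xy,
        F.cross_yx]
      ring
    simp only [cross_self, e]
    field_simp
    ring
  rw [hasDerivAt_iff_isLittleO] at h5
  have h6 := h5.def hε
  filter_upwards [h6] with s hs
  simpa [increment] using hs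

lemma increment_left (F : RadonFrame Ω A x y l m σ Θ) (a t : ℝ) {ε : ℝ} (hε : 0 < ε) :
    ∀ᶠ s in 𝓝 t, |increment x y a s t - (sweptArea A l m t - sweptArea A l m s)| ≤ ε := by
  have cw : Continuous fun s => x s + y s := F.x_cont.add F.y_cont
  have cU : ContinuousAt (sweptArea A l m) t := (F.hasDerivAt_sweptArea t).continuousAt
  have c1 : Continuous fun s => increment x y a s t := by
    unfold increment
    exact ((continuous_const.mul (Continuous.cross cw continuous_const)).mul
      (Continuous.cross continuous_const cw)).div_const _
  have c2 : ContinuousAt (fun s => |increment x y a s t -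
      (sweptArea A l m t - sweptArea A l m s)|) t :=
    (c1.continuousAt.sub (continuousAt_const.sub cU)).abs
  have e : |increment x y a t t - (sweptArea A l m t - sweptArea A l m t)| < ε := by
    simpa [increment] using hε
  exact (c2.eventually_lt continuousAt_const e).mono fun s hs => hs.le

lemma calibration_aux (F : RadonFrame Ω A x y l m σ Θ) (h : IsTable Ω) {a b : ℝ}
    (h1 : a < σ b) (h2 : σ b < a + Real.pi) :
    A + sweptArea A l m b - sweptArea A l m a ≤ generatingFunction Ω (Θ a) (Θ (σ b)) := by
  set g : ℝ → ℝ := fun t => generatingFunction Ω (Θ a) (Θ (σ t)) - sweptArea A l m t with hg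
  have ha1 := F.lt_σ a
  have ha2 := F.σ_lt a
  have hpos : ∀ t, a < σ t → σ t < a + Real.pi → 0 < cross (x a - y a) (x t + y t) :=
    fun t k1 k2 => (F.exists_optimal h k1 k2).1
  have main : g a ≤ g b := by
    rcases le_total a b with hab | hab
    · have adm : ∀ t ∈ Set.Icc a b, a < σ t ∧ σ t < a + Real.pi := fun t ht =>
        ⟨ha1.trans_le (F.σ_mono.monotone ht.1), (F.σ_mono.monotone ht.2).trans_lt h2⟩
      refine le_of_forall_local hab (fun t ht ε hε => ?_) (fun t ht ε hε => ?_)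
      · obtain ⟨k1, k2⟩ := adm t ⟨ht.1, ht.2.le⟩
        filter_upwards [(F.increment_right (hpos t k1 k2) hε).filter_mono nhdsWithin_le_nhds,
          self_mem_nhdsWithin, (eventually_lt_nhds ht.2).filter_mono nhdsWithin_le_nhds]
          with s hs hts hsb
        replace hts : t < s := hts
        obtain ⟨k1', k2'⟩ := adm s ⟨by linarith [ht.1], hsb.le⟩
        have := F.generatingFunction_increment h k1 k2 k1' k2' (Or.inl ⟨ht.1, hts.le⟩)
        rw [abs_of_pos (sub_pos.2 hts)] at hs
        have := (abs_le.1 hs).1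
        simp only [hg]
        linarith
      · obtain ⟨k1, k2⟩ := adm t ⟨ht.1.le, ht.2⟩
        filter_upwards [(F.increment_left a t hε).filter_mono nhdsWithin_le_nhds,
          self_mem_nhdsWithin, (eventually_gt_nhds ht.1).filter_mono nhdsWithin_le_nhds]
          with s hs hts hsa
        replace hts : s < t := hts
        obtain ⟨k1', k2'⟩ := adm s ⟨hsa.le, by linarith [ht.2]⟩
        have := F.generatingFunction_increment h k1' k2' k1 k2 (Or.inl ⟨hsa.le, hts.le⟩)
        have := (abs_le.1 hs).1
        simp only [hg]
        linarith
    · have adm : ∀ t ∈ Set.Icc b a, a < σ t ∧ σ t < a + Real.pi := fun t ht =>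
        ⟨h1.trans_le (F.σ_mono.monotone ht.1), (F.σ_mono.monotone ht.2).trans_lt ha2⟩
      refine le_of_forall_local' hab (fun t ht ε hε => ?_) (fun t ht ε hε => ?_)
      · obtain ⟨k1, k2⟩ := adm t ⟨ht.1.le, ht.2⟩
        filter_upwards [(F.increment_right (hpos t k1 k2) hε).filter_mono nhdsWithin_le_nhds,
          self_mem_nhdsWithin, (eventually_gt_nhds ht.1).filter_mono nhdsWithin_le_nhds]
          with s hs hts hsb
        replace hts : s < t := hts
        obtain ⟨k1', k2'⟩ := adm s ⟨hsb.le, by linarith [ht.2]⟩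
        have := F.generatingFunction_increment h k1 k2 k1' k2' (Or.inr ⟨hts.le, ht.2⟩)
        rw [abs_of_neg (sub_neg.2 hts)] at hs
        have := (abs_le.1 hs).1
        simp only [hg]
        linarith
      · obtain ⟨k1, k2⟩ := adm t ⟨ht.1, ht.2.le⟩
        filter_upwards [(F.increment_left a t hε).filter_mono nhdsWithin_le_nhds,
          self_mem_nhdsWithin, (eventually_lt_nhds ht.2).filter_mono nhdsWithin_le_nhds]
          with s hs hts hsa
        replace hts : t < s := hts
        obtain ⟨k1', k2'⟩ := adm s ⟨by linarith [ht.1], hsa.le⟩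
        have := F.generatingFunction_increment h k1' k2' k1 k2 (Or.inr ⟨hts.le, hsa.le⟩)
        have := (abs_le.1 hs).1
        simp only [hg]
        linarith
  simp only [hg, F.generatingFunction_σ h] at main
  linarith

/-- The area swept between conjugate points is constant. -/
lemma sweptArea_σ (F : RadonFrame Ω A x y l m σ Θ) (t : ℝ) :
    sweptArea A l m (σ t) = sweptArea A l m t + sweptArea A l m (σ 0) := by
  have hd : ∀ s, HasDerivAt (fun s => sweptArea A l m (σ s) - sweptArea A l m s) 0 s := by
    intro s
    have h1 := (F.hasDerivAt_sweptArea (σ s)).comp s (F.σ_diff s).hasDerivAt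
    refine (h1.sub (F.hasDerivAt_sweptArea s)).congr_deriv ?_
    have e1 := F.deriv_σ_mul_l s
    have e2 := F.deriv_σ_mul_m s
    linear_combination A / 2 * e1 + A / 2 * e2
  have := is_const_of_deriv_eq_zero (fun s => (hd s).differentiableAt) (fun s => (hd s).deriv) t 0
  have e0 : sweptArea A l m 0 = 0 := by simp [sweptArea]
  linarith

lemma σ_surjective (F : RadonFrame Ω A x y l m σ Θ) : Function.Surjective σ := fun b =>
  mem_range_of_exists_le_of_exists_ge F.σ_diff.continuous
    ⟨b - Real.pi, by linarith [F.σ_lt (b - Real.pi)]⟩ ⟨b, (F.lt_σ b).le⟩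

/-- The swept area calibrates the generating function. -/
lemma calibration (F : RadonFrame Ω A x y l m σ Θ) (h : IsTable Ω) {a b : ℝ}
    (h1 : a < b) (h2 : b < a + Real.pi) :
    A - sweptArea A l m (σ 0) + sweptArea A l m b - sweptArea A l m a ≤
      generatingFunction Ω (Θ a) (Θ b) := by
  obtain ⟨b, rfl⟩ := F.σ_surjective b
  have := F.calibration_aux h h1 h2
  rw [F.sweptArea_σ b]
  linarith

end RadonFrame

/-! ### Action sums -/

lemma sum_Ico_int_sub (u : ℤ → ℝ) {m n : ℤ} (hmn : m ≤ n) :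
    ∑ i ∈ Finset.Ico m n, (u (i + 1) - u i) = u n - u m := by
  induction n, hmn using Int.leInduction with
  | base => simp
  | succ n hmn ih =>
    rw [← Finset.insert_Ico_right_eq_Ico_add_one hmn, Finset.sum_insert (by simp), ih]
    ring

lemma le_segmentAction {S : ℝ → ℝ → ℝ} {z u : ℤ → ℝ} {c : ℝ} {m n : ℤ} (hmn : m ≤ n)
    (hS : ∀ i ∈ Finset.Ico m n, c + u (i + 1) - u i ≤ S (z i) (z (i + 1))) :
    (n - m) * c + u n - u m ≤ segmentAction S z m n := by
  have h1 := Finset.sum_le_sum hS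
  have h2 : ∑ i ∈ Finset.Ico m n, (c + u (i + 1) - u i) = (n - m) * c + u n - u m := by
    have e : ∀ i ∈ Finset.Ico m n, c + u (i + 1) - u i = c + (u (i + 1) - u i) :=
      fun i _ => by ring
    rw [Finset.sum_congr rfl e, Finset.sum_add_distrib, sum_Ico_int_sub u hmn, Finset.sum_const,
      Int.card_Ico, nsmul_eq_mul]
    have : ((n - m).toNat : ℝ) = (n : ℝ) - m := by
      have := Int.toNat_of_nonneg (sub_nonneg.2 hmn)
      exact_mod_cast congrArg (fun k : ℤ => (k : ℝ)) this
    rw [this]; ring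
  rwa [h2] at h1

lemma segmentAction_le {S : ℝ → ℝ → ℝ} {z : ℤ → ℝ} {c : ℝ} {m n : ℤ} (hmn : m ≤ n)
    (hS : ∀ i ∈ Finset.Ico m n, S (z i) (z (i + 1)) ≤ c) :
    segmentAction S z m n ≤ (n - m) * c := by
  have h1 := Finset.sum_le_sum hS
  rw [Finset.sum_const, Int.card_Ico, nsmul_eq_mul] at h1
  have : ((n - m).toNat : ℝ) = (n : ℝ) - m := by
    have := Int.toNat_of_nonneg (sub_nonneg.2 hmn)
    exact_mod_cast congrArg (fun k : ℤ => (k : ℝ)) this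
  rwa [this] at h1

lemma exists_abs_le_of_periodic {g : ℝ → ℝ} (hc : Continuous g)
    (hp : ∀ t, g (t + Real.pi) = g t) : ∃ C, ∀ t, |g t| ≤ C := by
  obtain ⟨C, hC⟩ := (Function.Periodic.isBounded_of_continuous (f := g) hp Real.pi_ne_zero
    hc).exists_norm_le
  exact ⟨C, fun t => hC _ (Set.mem_range_self t)⟩

lemma add_int_mul_pi {f : ℝ → ℝ} (hf : ∀ t, f (t + Real.pi) = f t + Real.pi) (t : ℝ) (k : ℤ) :
    f (t + k * Real.pi) = f t + k * Real.pi := by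
  have hp : Function.Periodic (fun t => f t - t) Real.pi := fun t => by
    simp only [hf]; ring
  have := hp.int_mul k t
  linarith

lemma hasRotationNumber_of_bounded {z : ℤ → ℝ} {C : ℝ}
    (hz : ∀ i : ℤ, |z i - i * (Real.pi / 2)| ≤ C) : HasRotationNumber z (1 / 4) := by
  have key : ∀ L : Filter ℤ, Tendsto (fun i : ℤ => |(i : ℝ)|) L atTop →
      Tendsto (fun i : ℤ => z i / (2 * Real.pi * (i : ℝ))) L (𝓝 (1 / 4)) := by
    intro L hL
    rw [tendsto_iff_norm_sub_tendsto_zero]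
    have h0 : Tendsto (fun i : ℤ => C / (2 * Real.pi) * |(i : ℝ)|⁻¹) L (𝓝 0) := by
      simpa using (tendsto_inv_atTop_zero.comp hL).const_mul (C / (2 * Real.pi))
    refine squeeze_zero' (Eventually.of_forall fun _ => norm_nonneg _) ?_ h0
    filter_upwards [hL.eventually_gt_atTop 0] with i hi
    have hi0 : (i : ℝ) ≠ 0 := abs_pos.1 hi
    have hpi := Real.pi_pos
    have e : z i / (2 * Real.pi * (i : ℝ)) - 1 / 4 =
        (z i - i * (Real.pi / 2)) / (2 * Real.pi * i) := by
      field_simp; ring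
    rw [e, Real.norm_eq_abs, abs_div, abs_mul, abs_of_pos (by positivity : 0 < 2 * Real.pi),
      div_mul_eq_mul_div, ← div_eq_mul_inv, div_div, mul_comm (2 * Real.pi)]
    exact div_le_div_of_nonneg_right (hz i) (by positivity)
  exact ⟨key _ (tendsto_abs_atTop_atTop.comp tendsto_intCast_atTop_atTop),
    key _ (tendsto_abs_atBot_atTop.comp (tendsto_intCast_atBot_iff.2 tendsto_id))⟩

namespace RadonFrame

variable {Ω : Set Plane} {A : ℝ} {x y : ℝ → Plane} {l m σ Θ : ℝ → ℝ}

lemma σ_σ (F : RadonFrame Ω A x y l m σ Θ) (t : ℝ) : σ (σ t) = t + Real.pi := by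
  obtain ⟨ρ, hρ, e⟩ := F.polar t
  obtain ⟨ρ', hρ', e'⟩ := F.polar (σ (σ t))
  rw [F.x_σ, F.y_σ, F.y_σ, F.x_σ] at e'
  have h1 : cross (x t - y t) (-x t - -y t) = 0 := by
    have : -x t - -y t = -(x t - y t) := by abel
    rw [this, cross_neg_right, cross_self, neg_zero]
  rw [e, e', cross_smul_left, cross_smul_right, cross_dir] at h1
  have hsin : Real.sin (Θ (σ (σ t)) - Θ t) = 0 := by
    simpa [hρ.ne', hρ'.ne'] using h1
  have a1 := F.lt_σ t
  have a2 := F.lt_σ (σ t)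
  have a3 := F.σ_lt t
  have a4 := F.σ_lt (σ t)
  have b1 := F.Θ_mono (a1.trans a2)
  have b2 := F.Θ_mono (by linarith : σ (σ t) < t + Real.pi + Real.pi)
  rw [F.Θ_add_pi, F.Θ_add_pi] at b2
  obtain ⟨n, hn⟩ := Real.sin_eq_zero_iff.1 hsin
  have hpi := Real.pi_pos
  have n1 : 0 < n := by
    have : (0 : ℝ) < n := (pos_iff_pos_of_mul_pos (by linarith)).2 hpi
    exact_mod_cast this
  have n2 : n < 2 := by
    have : (n : ℝ) < 2 := by
      by_contra hge
      push Not at hge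
      nlinarith
    exact_mod_cast this
  have n3 : n = 1 := by omega
  rw [n3] at hn
  apply F.Θ_mono.injective
  rw [F.Θ_add_pi]
  push_cast at hn
  linarith

lemma sweptArea_add_pi (F : RadonFrame Ω A x y l m σ Θ) (t : ℝ) :
    sweptArea A l m (t + Real.pi) = sweptArea A l m t + 2 * sweptArea A l m (σ 0) := by
  rw [← F.σ_σ, F.sweptArea_σ, F.sweptArea_σ]; ring

lemma sweptArea_cont (F : RadonFrame Ω A x y l m σ Θ) : Continuous (sweptArea A l m) :=
  continuous_iff_continuousAt.2 fun t => (F.hasDerivAt_sweptArea t).continuousAt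

lemma exists_Θ_sub_le (F : RadonFrame Ω A x y l m σ Θ) : ∃ C, ∀ t, |Θ t - t| ≤ C :=
  exists_abs_le_of_periodic (F.Θ_cont.sub continuous_id) fun t => by
    simp only [F.Θ_add_pi]; ring

lemma Θ_surjective (F : RadonFrame Ω A x y l m σ Θ) : Function.Surjective Θ := fun φ => by
  obtain ⟨C, hC⟩ := F.exists_Θ_sub_le
  exact mem_range_of_exists_le_of_exists_ge F.Θ_cont
    ⟨φ - C, by linarith [(abs_le.1 (hC (φ - C))).2]⟩
    ⟨φ + C, by linarith [(abs_le.1 (hC (φ + C))).1]⟩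

lemma exists_sweptArea_sub_le (F : RadonFrame Ω A x y l m σ Θ) :
    ∃ C, ∀ t, |sweptArea A l m t - 2 * sweptArea A l m (σ 0) / Real.pi * Θ t| ≤ C :=
  exists_abs_le_of_periodic (F.sweptArea_cont.sub (continuous_const.mul F.Θ_cont)) fun t => by
    simp only [F.Θ_add_pi, F.sweptArea_add_pi]
    have := Real.pi_ne_zero
    field_simp
    ring

lemma lt_of_admissible (F : RadonFrame Ω A x y l m σ Θ) {a b : ℝ}
    (h : Admissible (Θ a) (Θ b)) : a < b ∧ b < a + Real.pi :=
  ⟨F.Θ_mono.lt_iff_lt.1 h.1, F.Θ_mono.lt_iff_lt.1 (by rw [F.Θ_add_pi]; exact h.2)⟩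

/-- Lower bound for the action of a segment. -/
lemma le_action (F : RadonFrame Ω A x y l m σ Θ) (h : IsTable Ω) {a : ℤ → ℝ} {j k : ℤ}
    (hjk : j ≤ k) (hadm : ∀ i ∈ Finset.Ico j k, Admissible (Θ (a i)) (Θ (a (i + 1)))) :
    (k - j) * (A - sweptArea A l m (σ 0)) + sweptArea A l m (a k) - sweptArea A l m (a j) ≤
      segmentAction (generatingFunction Ω) (fun i => Θ (a i)) j k :=
  le_segmentAction (u := fun i => sweptArea A l m (a i)) hjk fun i hi => by
    obtain ⟨h1, h2⟩ := F.lt_of_admissible (hadm i hi)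
    exact F.calibration h h1 h2

/-- The four-periodic orbits on the invariant curve are action-minimizing. -/
theorem exists_minimal (F : RadonFrame Ω A x y l m σ Θ) (h : IsTable Ω) :
    ∃ z : ℤ → ℝ, IsMinimalConfiguration (generatingFunction Ω) z ∧
      HasRotationNumber z (1 / 4) := by
  set a : ℤ → ℝ := fun i => (if i % 2 = 0 then 0 else σ 0) + (i / 2 : ℤ) * Real.pi with ha
  have hstep : ∀ i, a (i + 1) = σ (a i) := by
    intro i
    simp only [ha]
    rw [add_int_mul_pi F.σ_add_pi]
    rcases Int.emod_two_eq_zero_or_one i with h0 | h0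
    · have e1 : (i + 1) % 2 = 1 := by omega
      have e2 : (i + 1) / 2 = i / 2 := by omega
      simp [h0, e1, e2]
    · have e1 : (i + 1) % 2 = 0 := by omega
      have e2 : (i + 1) / 2 = i / 2 + 1 := by omega
      simp [h0, e1, e2, F.σ_σ]
      ring
  have hadm : ∀ i, Admissible (Θ (a i)) (Θ (a (i + 1))) := fun i => by
    rw [hstep]; exact F.admissible (F.lt_σ _) (F.σ_lt _)
  refine ⟨fun i => Θ (a i), ⟨hadm, ?_⟩, ?_⟩
  · intro j k hjk z hz hzj hzk
    choose b hb using fun i => F.Θ_surjective (z i)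
    obtain rfl : z = fun i => Θ (b i) := funext fun i => (hb i).symm
    have hj := F.Θ_mono.injective hzj
    have hk := F.Θ_mono.injective hzk
    have h1 := F.le_action h hjk.le hz
    have h2 : segmentAction (generatingFunction Ω) (fun i => Θ (a i)) j k ≤ (k - j) * A :=
      segmentAction_le hjk.le fun i _ => by
        simp only [hstep, F.generatingFunction_σ h, le_refl]
    have h3 : sweptArea A l m (a k) - sweptArea A l m (a j) =
        (k - j) * sweptArea A l m (σ 0) := by
      have h4 := sum_Ico_int_sub (fun i => sweptArea A l m (a i)) hjk.le
      rw [← h4]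
      have e : ∀ i ∈ Finset.Ico j k, sweptArea A l m (a (i + 1)) - sweptArea A l m (a i) =
          sweptArea A l m (σ 0) := fun i _ => by rw [hstep, F.sweptArea_σ]; ring
      rw [Finset.sum_congr rfl e, Finset.sum_const, Int.card_Ico, nsmul_eq_mul]
      congr 1
      have := Int.toNat_of_nonneg (sub_nonneg.2 hjk.le)
      exact_mod_cast congrArg (fun k : ℤ => (k : ℝ)) this
    rw [hj, hk] at h1
    linarith
  · obtain ⟨C, hC⟩ := F.exists_Θ_sub_le
    refine hasRotationNumber_of_bounded (C := C + Real.pi) fun i => ?_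
    have h1 : |a i - i * (Real.pi / 2)| ≤ Real.pi := by
      have e := Int.emod_add_mul_ediv i 2
      have hpi := Real.pi_pos
      have s1 := F.lt_σ 0
      have s2 := F.σ_lt 0
      simp only [ha]
      rcases Int.emod_two_eq_zero_or_one i with h0 | h0
      · rw [h0] at e
        have e' : (i : ℝ) = 2 * (i / 2 : ℤ) := by exact_mod_cast (by omega : i = 2 * (i / 2))
        rw [if_pos h0, e', abs_le]
        constructor <;> linarith
      · have e' : (i : ℝ) = 2 * (i / 2 : ℤ) + 1 := by
          exact_mod_cast (by omega : i = 2 * (i / 2) + 1)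
        rw [if_neg (by omega), e', abs_le]
        constructor <;> linarith
    calc |Θ (a i) - i * (Real.pi / 2)| = |(Θ (a i) - a i) + (a i - i * (Real.pi / 2))| := by
          congr 1; ring
      _ ≤ |Θ (a i) - a i| + |a i - i * (Real.pi / 2)| := abs_add_le _ _
      _ ≤ C + Real.pi := add_le_add (hC _) h1

lemma generatingFunction_le (F : RadonFrame Ω A x y l m σ Θ) (h : IsTable Ω) {φ₁ φ₂ a : ℝ}
    (hadm : Admissible φ₁ φ₂) (h1 : 0 < cross (dir φ₁) (y a)) (h2 : 0 < cross (dir φ₂) (y a)) :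
    generatingFunction Ω φ₁ φ₂ ≤ A ^ 2 * Real.sin (φ₂ - φ₁) /
      (2 * (cross (dir φ₁) (y a) * cross (dir φ₂) (y a))) := by
  obtain ⟨s, t, hs, ht, hmem, -, hS⟩ := h.exists_optimal hadm
  have h3 := F.cross_le a _ hmem
  rw [cross_add_left, cross_smul_left, cross_smul_left] at h3
  set p := cross (dir φ₁) (y a)
  set q := cross (dir φ₂) (y a)
  have hsin := Real.sin_pos_of_pos_of_lt_pi (x := φ₂ - φ₁) (by linarith [hadm.1])
    (by linarith [hadm.2])
  have hA := F.A_pos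
  have h4 : 4 * ((s * p) * (t * q)) ≤ A ^ 2 := by
    have : 0 ≤ s * p + t * q := by positivity
    nlinarith [sq_nonneg (s * p - t * q)]
  rw [hS, le_div_iff₀ (by positivity)]
  nlinarith

/-- Near the invariant curve the generating function is almost `A`, uniformly. -/
lemma exists_uniform (F : RadonFrame Ω A x y l m σ Θ) (h : IsTable Ω) {η : ℝ} (hη : 0 < η) :
    ∃ δ > 0, ∀ a ε : ℝ, |ε| < δ → Admissible (Θ a) (Θ (σ a) + ε) ∧
      generatingFunction Ω (Θ a) (Θ (σ a) + ε) ≤ A + η := by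
  have hA := F.A_pos
  set P : ℝ → ℝ → Prop := fun ε a => Θ a < Θ (σ a) + ε ∧ Θ (σ a) + ε < Θ a + Real.pi ∧
    0 < cross (dir (Θ a)) (y a) ∧ 0 < cross (dir (Θ (σ a) + ε)) (y a) ∧
    A ^ 2 * Real.sin (Θ (σ a) + ε - Θ a) /
      (2 * (cross (dir (Θ a)) (y a) * cross (dir (Θ (σ a) + ε)) (y a))) < A + η with hP
  have hper : ∀ ε, Function.Periodic (P ε) Real.pi := by
    intro ε a
    have e1 : Θ (σ a) + Real.pi + ε = Θ (σ a) + ε + Real.pi := by ring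
    simp only [hP, F.σ_add_pi, F.Θ_add_pi, F.y_add_pi, e1, dir_add_pi, cross_neg_left,
      cross_neg_right, neg_neg, add_lt_add_iff_right, add_sub_add_right_eq_sub]
  have hloc : ∀ a ∈ Set.Icc (0 : ℝ) Real.pi, ∀ᶠ z : ℝ × ℝ in 𝓝 ((0 : ℝ), a), P z.1 z.2 := by
    intro a _
    obtain ⟨ρ, hρ, e⟩ := F.polar a
    obtain ⟨ρ', hρ', e'⟩ := F.polar_σ a
    have d1 : dir (Θ a) = ρ⁻¹ • (x a - y a) := by
      rw [e, smul_smul, inv_mul_cancel₀ hρ.ne', one_smul]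
    have d2 : dir (Θ (σ a)) = ρ'⁻¹ • (x a + y a) := by
      rw [e', smul_smul, inv_mul_cancel₀ hρ'.ne', one_smul]
    have f1 : cross (dir (Θ a)) (y a) = ρ⁻¹ * A := by
      rw [d1, cross_smul_left, cross_sub_left, cross_self, F.cross_xy, sub_zero]
    have f2 : cross (dir (Θ (σ a))) (y a) = ρ'⁻¹ * A := by
      rw [d2, cross_smul_left, cross_add_left, cross_self, F.cross_xy, add_zero]
    have f3 : Real.sin (Θ (σ a) - Θ a) = ρ⁻¹ * (ρ'⁻¹ * (2 * A)) := by
      rw [← cross_dir, d1, d2, cross_smul_left, cross_smul_right, F.cross_vw]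
    have f4 : A ^ 2 * Real.sin (Θ (σ a) - Θ a) /
        (2 * (cross (dir (Θ a)) (y a) * cross (dir (Θ (σ a))) (y a))) = A := by
      rw [f1, f2, f3]
      field_simp
    have c0 : Continuous fun z : ℝ × ℝ => Θ z.2 := F.Θ_cont.comp continuous_snd
    have c1 : Continuous fun z : ℝ × ℝ => Θ (σ z.2) + z.1 :=
      (F.Θ_cont.comp (F.σ_diff.continuous.comp continuous_snd)).add continuous_fst
    have cd : Continuous dir := (contDiff_dir (n := 0)).continuous
    have cy : Continuous fun z : ℝ × ℝ => y z.2 := F.y_cont.comp continuous_snd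
    have c2 : Continuous fun z : ℝ × ℝ => cross (dir (Θ z.2)) (y z.2) :=
      Continuous.cross (cd.comp c0) cy
    have c3 : Continuous fun z : ℝ × ℝ => cross (dir (Θ (σ z.2) + z.1)) (y z.2) :=
      Continuous.cross (cd.comp c1) cy
    have c4 : Continuous fun z : ℝ × ℝ => A ^ 2 * Real.sin (Θ (σ z.2) + z.1 - Θ z.2) :=
      continuous_const.mul (Real.continuous_sin.comp (c1.sub c0))
    have p1 : 0 < cross (dir (Θ a)) (y a) := by rw [f1]; positivity
    have p2 : 0 < cross (dir (Θ (σ a) + 0)) (y a) := by rw [add_zero, f2]; positivity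
    have hadm := F.admissible (F.lt_σ a) (F.σ_lt a)
    have e1 : ∀ᶠ z : ℝ × ℝ in 𝓝 ((0 : ℝ), a), Θ z.2 < Θ (σ z.2) + z.1 :=
      c0.continuousAt.eventually_lt c1.continuousAt (by simpa using hadm.1)
    have e2 : ∀ᶠ z : ℝ × ℝ in 𝓝 ((0 : ℝ), a), Θ (σ z.2) + z.1 < Θ z.2 + Real.pi :=
      c1.continuousAt.eventually_lt (c0.add continuous_const).continuousAt (by simpa using hadm.2)
    have e3 : ∀ᶠ z : ℝ × ℝ in 𝓝 ((0 : ℝ), a), 0 < cross (dir (Θ z.2)) (y z.2) :=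
      continuousAt_const.eventually_lt c2.continuousAt p1
    have e4 : ∀ᶠ z : ℝ × ℝ in 𝓝 ((0 : ℝ), a), 0 < cross (dir (Θ (σ z.2) + z.1)) (y z.2) :=
      continuousAt_const.eventually_lt c3.continuousAt p2
    have c5 : Continuous fun z : ℝ × ℝ =>
        2 * (cross (dir (Θ z.2)) (y z.2) * cross (dir (Θ (σ z.2) + z.1)) (y z.2)) :=
      continuous_const.mul (c2.mul c3)
    have c6 : ContinuousAt (fun z : ℝ × ℝ => A ^ 2 * Real.sin (Θ (σ z.2) + z.1 - Θ z.2) /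
        (2 * (cross (dir (Θ z.2)) (y z.2) * cross (dir (Θ (σ z.2) + z.1)) (y z.2)))) (0, a) :=
      c4.continuousAt.div c5.continuousAt (mul_pos two_pos (mul_pos p1 p2)).ne'
    have e5 := c6.eventually (eventually_lt_nhds (b := A + η) (by
      change A ^ 2 * Real.sin (Θ (σ a) + 0 - Θ a) /
        (2 * (cross (dir (Θ a)) (y a) * cross (dir (Θ (σ a) + 0)) (y a))) < A + η
      rw [add_zero, f4]
      linarith))
    filter_upwards [e1, e2, e3, e4, e5] with z h1 h2 h3 h4 h5
    exact ⟨h1, h2, h3, h4, h5⟩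
  have hev := isCompact_Icc.eventually_forall_of_forall_eventually hloc
  obtain ⟨δ, hδ, hball⟩ := Metric.eventually_nhds_iff.1 hev
  refine ⟨δ, hδ, fun a ε hε => ?_⟩
  obtain ⟨a', ha', e⟩ := (hper ε).exists_mem_Ico₀ Real.pi_pos a
  have hPa : P ε a := e ▸ hball (by simpa using hε) a' ⟨ha'.1, ha'.2.le⟩
  obtain ⟨k1, k2, k3, k4, k5⟩ := hPa
  exact ⟨⟨k1, k2⟩, (F.generatingFunction_le h ⟨k1, k2⟩ k3 k4).trans k5.le⟩

/-- Comparison with a sequence close to the invariant curve. -/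
lemma action_le (F : RadonFrame Ω A x y l m σ Θ) {η δ : ℝ}
    (hδ : ∀ a ε : ℝ, |ε| < δ → Admissible (Θ a) (Θ (σ a) + ε) ∧
      generatingFunction Ω (Θ a) (Θ (σ a) + ε) ≤ A + η)
    {z : ℤ → ℝ} (hz : IsMinimalConfiguration (generatingFunction Ω) z) {N : ℕ} (hN : 0 < N)
    (hε : |(z N - z (-(N : ℤ))) / N - Real.pi| < δ) :
    segmentAction (generatingFunction Ω) z (-(N : ℤ)) N ≤ 2 * N * (A + η) := by
  have hNr : (0 : ℝ) < N := by exact_mod_cast hN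
  set ε := (z N - z (-(N : ℤ))) / N - Real.pi with hεdef
  obtain ⟨Φ, hΦ⟩ := F.Θ_surjective.hasRightInverse
  set b : ℤ → ℝ := fun j => Φ (z (-(N : ℤ)) + j * (Real.pi + ε)) with hb
  have hΘb : ∀ j, Θ (b j) = z (-(N : ℤ)) + j * (Real.pi + ε) := fun j => hΦ _
  set u : ℤ → ℝ := fun i => if (i + N) % 2 = 0 then Θ (b ((i + N) / 2))
    else Θ (σ (b ((i + N) / 2))) with hu
  have hδ0 : 0 < δ := (abs_nonneg _).trans_lt hε
  have hstep : ∀ i, Admissible (u i) (u (i + 1)) ∧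
      generatingFunction Ω (u i) (u (i + 1)) ≤ A + η := by
    intro i
    rcases Int.emod_two_eq_zero_or_one (i + N) with h0 | h0
    · have e1 : (i + 1 + N) % 2 ≠ 0 := by omega
      have e2 : (i + 1 + N) / 2 = (i + N) / 2 := by omega
      simp only [hu]
      rw [if_pos h0, if_neg e1, e2]
      have := hδ (b ((i + N) / 2)) 0 (by simpa using hδ0)
      simpa using this
    · have e1 : (i + 1 + N) % 2 = 0 := by omega
      have e2 : (i + 1 + N) / 2 = (i + N) / 2 + 1 := by omega
      have e3 : ¬ (i + N) % 2 = 0 := by omega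
      simp only [hu]
      rw [if_pos e1, if_neg e3, e2]
      have := hδ (σ (b ((i + N) / 2))) ε hε
      rw [F.σ_σ, F.Θ_add_pi] at this
      have e4 : Θ (b ((i + N) / 2 + 1)) = Θ (b ((i + N) / 2)) + Real.pi + ε := by
        rw [hΘb, hΘb]; push_cast; ring
      rw [e4]; exact this
  have hneg : u (-(N : ℤ)) = z (-(N : ℤ)) := by
    simp only [hu]
    rw [if_pos (by simp), hΘb]
    simp
  have hpos : u N = z N := by
    have e1 : ((N : ℤ) + N) % 2 = 0 := by omega
    have e2 : ((N : ℤ) + N) / 2 = N := by omega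
    simp only [hu]
    rw [if_pos e1, e2, hΘb, hεdef]
    push_cast
    field_simp
    ring
  have hlt : -(N : ℤ) < N := by omega
  have h1 := hz.minimal (-(N : ℤ)) N hlt u (fun i _ => (hstep i).1) hneg hpos
  have h2 := segmentAction_le (S := generatingFunction Ω) hlt.le fun i _ => (hstep i).2
  push_cast at h2
  linarith

theorem hasAverageAction (F : RadonFrame Ω A x y l m σ Θ) (h : IsTable Ω) {z : ℤ → ℝ}
    (hz : IsMinimalConfiguration (generatingFunction Ω) z) (hrot : HasRotationNumber z (1 / 4)) :
    HasAverageAction (generatingFunction Ω) z A := by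
  have hpi := Real.pi_pos
  have t1 : Tendsto (fun N : ℕ => z N / (2 * Real.pi * ((N : ℤ) : ℝ))) atTop (𝓝 (1 / 4)) :=
    hrot.1.comp tendsto_natCast_atTop_atTop
  have t2 : Tendsto (fun N : ℕ => z (-(N : ℤ)) / (2 * Real.pi * ((-(N : ℤ) : ℤ) : ℝ))) atTop
      (𝓝 (1 / 4)) := hrot.2.comp (tendsto_neg_atTop_atBot.comp tendsto_natCast_atTop_atTop)
  have t3 : Tendsto (fun N : ℕ => (z N - z (-(N : ℤ))) / N) atTop (𝓝 Real.pi) := by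
    have := (t1.add t2).const_mul (2 * Real.pi)
    rw [show 2 * Real.pi * (1 / 4 + 1 / 4) = Real.pi by ring] at this
    refine this.congr' ?_
    filter_upwards [eventually_gt_atTop 0] with N hN
    have hNr : (N : ℝ) ≠ 0 := by positivity
    push_cast
    field_simp
    ring
  set Q := sweptArea A l m (σ 0)
  obtain ⟨C, hC⟩ := F.exists_sweptArea_sub_le
  have hlow : ∀ᶠ N : ℕ in atTop, A - Q + Q / Real.pi * ((z N - z (-(N : ℤ))) / N) - C * (N : ℝ)⁻¹ ≤
      1 / (2 * (N : ℝ)) * segmentAction (generatingFunction Ω) z (-(N : ℤ)) N := by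
    filter_upwards [eventually_gt_atTop 0] with N hN
    have hNr : (0 : ℝ) < N := by exact_mod_cast hN
    choose a ha using fun i => F.Θ_surjective (z i)
    obtain rfl : z = fun i => Θ (a i) := funext fun i => (ha i).symm
    have h1 := F.le_action h (by omega : -(N : ℤ) ≤ N) (fun i _ => hz.admissible i)
    have h2 := (abs_le.1 (hC (a N))).1
    have h3 := (abs_le.1 (hC (a (-(N : ℤ))))).2
    push_cast at h1
    have h4 : 2 * N * (A - Q) + 2 * Q / Real.pi * (Θ (a N) - Θ (a (-(N : ℤ)))) - 2 * C ≤
        segmentAction (generatingFunction Ω) (fun i => Θ (a i)) (-(N : ℤ)) N := by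
      linarith
    have h5 := mul_le_mul_of_nonneg_left h4 (by positivity : 0 ≤ 1 / (2 * (N : ℝ)))
    refine le_trans (le_of_eq ?_) h5
    field_simp
  have tlow : Tendsto (fun N : ℕ => A - Q + Q / Real.pi * ((z N - z (-(N : ℤ))) / N) -
      C * (N : ℝ)⁻¹) atTop (𝓝 A) := by
    have := ((t3.const_mul (Q / Real.pi)).const_add (A - Q)).sub
      (tendsto_inv_atTop_nhds_zero_nat.const_mul C)
    convert this using 2
    field_simp
    ring
  rw [HasAverageAction, Metric.tendsto_atTop']
  intro η hη
  obtain ⟨δ, hδ0, hδ⟩ := F.exists_uniform h (half_pos hη)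
  have e1 := (Metric.tendsto_nhds.1 t3) δ hδ0
  have e2 := (Metric.tendsto_nhds.1 tlow) η hη
  obtain ⟨N₀, hN₀⟩ := eventually_atTop.1 (e1.and (e2.and (hlow.and (eventually_gt_atTop 0))))
  refine ⟨N₀, fun N hN => ?_⟩
  obtain ⟨k1, k2, k3, k4⟩ := hN₀ N hN.le
  have hNr : (0 : ℝ) < N := by exact_mod_cast k4
  have hup := F.action_le hδ hz k4 k1
  have hup2 := mul_le_mul_of_nonneg_left hup (by positivity : 0 ≤ 1 / (2 * (N : ℝ)))
  have e3 : 1 / (2 * (N : ℝ)) * (2 * N * (A + η / 2)) = A + η / 2 := by field_simp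
  rw [e3] at hup2
  rw [Real.dist_eq, abs_lt] at k2 ⊢
  constructor <;> linarith [k2.1]

theorem isMinimalAverageAction (F : RadonFrame Ω A x y l m σ Θ) (h : IsTable Ω) :
    IsMinimalAverageAction (generatingFunction Ω) (1 / 4) A :=
  ⟨F.exists_minimal h, fun _ hz hrot => F.hasAverageAction h hz hrot⟩

theorem betaOut_eq (F : RadonFrame Ω A x y l m σ Θ) (h : IsTable Ω) :
    betaOut Ω (1 / 4) = A := by
  have h1 : IsMinimalAverageAction (generatingFunction Ω) (1 / 4) (betaOut Ω (1 / 4)) :=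
    Classical.epsilon_spec ⟨A, F.isMinimalAverageAction h⟩
  obtain ⟨z, hz, hrot⟩ := F.exists_minimal h
  exact tendsto_nhds_unique (h1.2 z hz hrot) (F.hasAverageAction h hz hrot)

end RadonFrame

/-! ### The isoperimetric inequality for Radon curves -/

lemma tendsto_sq_div_of_hasDerivAt {f u : ℝ → ℝ} {f' u' p : ℝ} (hf : HasDerivAt f f' p)
    (hu : HasDerivAt u u' p) (hf0 : f p = 0) (hu0 : u p = 0) (hu' : u' ≠ 0) :
    Tendsto (fun t => f t ^ 2 / u t) (𝓝[≠] p) (𝓝 0) := by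
  have h1 := hasDerivAt_iff_tendsto_slope.1 hf
  have h2 := hasDerivAt_iff_tendsto_slope.1 hu
  have h3 : Tendsto f (𝓝[≠] p) (𝓝 0) := by
    have := hf.continuousAt.tendsto
    rw [hf0] at this
    exact this.mono_left nhdsWithin_le_nhds
  have h4 := h3.mul (h1.div h2 hu')
  rw [zero_mul] at h4
  refine h4.congr' ?_
  filter_upwards [self_mem_nhdsWithin] with t ht
  have ht0 : t - p ≠ 0 := sub_ne_zero.2 ht
  simp only [Pi.div_apply, slope_def_field, hf0, hu0, sub_zero]
  rw [div_div_div_cancel_right₀ ht0]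
  ring

namespace RadonFrame

variable {Ω : Set Plane} {A : ℝ} {x y : ℝ → Plane} {l m σ Θ : ℝ → ℝ}

/-- The area parameter of a Radon curve. -/
def areaParam (l : ℝ → ℝ) (t : ℝ) : ℝ := ∫ s in (0 : ℝ)..t, l s

lemma hasDerivAt_areaParam (F : RadonFrame Ω A x y l m σ Θ) (t : ℝ) :
    HasDerivAt (areaParam l) (l t) t :=
  (F.l_cont.integral_hasStrictDerivAt 0 t).hasDerivAt

lemma areaParam_cont (F : RadonFrame Ω A x y l m σ Θ) : Continuous (areaParam l) :=
  continuous_iff_continuousAt.2 fun t => (F.hasDerivAt_areaParam t).continuousAt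

lemma areaParam_mono (F : RadonFrame Ω A x y l m σ Θ) : StrictMono (areaParam l) :=
  strictMono_of_deriv_pos fun t => by rw [(F.hasDerivAt_areaParam t).deriv]; exact F.l_pos t

@[simp] lemma areaParam_zero (l : ℝ → ℝ) : areaParam l 0 = 0 := by simp [areaParam]

lemma areaParam_add_pi (F : RadonFrame Ω A x y l m σ Θ) (t : ℝ) :
    areaParam l (t + Real.pi) = areaParam l t + areaParam l Real.pi := by
  have hd : ∀ s, HasDerivAt (fun s => areaParam l (s + Real.pi) - areaParam l s) 0 s := by
    intro s
    refine (((F.hasDerivAt_areaParam (s + Real.pi)).comp_add_const s Real.pi).sub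
      (F.hasDerivAt_areaParam s)).congr_deriv ?_
    rw [F.l_add_pi, sub_self]
  have := is_const_of_deriv_eq_zero (fun s => (hd s).differentiableAt) (fun s => (hd s).deriv) t 0
  simp only [zero_add, areaParam_zero, sub_zero] at this
  linarith

lemma areaParam_pi_pos (F : RadonFrame Ω A x y l m σ Θ) : 0 < areaParam l Real.pi := by
  have := F.areaParam_mono Real.pi_pos
  rwa [areaParam_zero] at this

lemma integral_m (F : RadonFrame Ω A x y l m σ Θ) :
    ∫ t in (0 : ℝ)..Real.pi, m t = areaParam l Real.pi := by
  have hd : ∀ s, HasDerivAt (fun s => areaParam l (σ s)) (m s) s := fun s => by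
    refine ((F.hasDerivAt_areaParam (σ s)).comp s (F.σ_diff s).hasDerivAt).congr_deriv ?_
    rw [mul_comm, F.deriv_σ_mul_l]
  rw [intervalIntegral.integral_eq_sub_of_hasDerivAt (fun s _ => hd s)
    (F.m_cont.intervalIntegrable _ _)]
  have := F.σ_add_pi 0
  rw [zero_add] at this
  rw [this, F.areaParam_add_pi]
  ring

lemma areaParam_surjective (F : RadonFrame Ω A x y l m σ Θ) :
    Function.Surjective (areaParam l) := by
  have hH := F.areaParam_pi_pos
  have hpi := Real.pi_pos
  set k := areaParam l Real.pi / Real.pi with hk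
  have hk0 : 0 < k := by positivity
  obtain ⟨C, hC⟩ := exists_abs_le_of_periodic (g := fun t => areaParam l t - k * t)
    (F.areaParam_cont.sub (continuous_const.mul continuous_id)) fun t => by
      rw [F.areaParam_add_pi, hk]; field_simp; ring
  intro c
  refine mem_range_of_exists_le_of_exists_ge F.areaParam_cont ⟨(c - C) / k, ?_⟩ ⟨(c + C) / k, ?_⟩
  · have := (abs_le.1 (hC ((c - C) / k))).2
    rw [mul_div_cancel₀ _ hk0.ne'] at this
    linarith
  · have := (abs_le.1 (hC ((c + C) / k))).1
    rw [mul_div_cancel₀ _ hk0.ne'] at this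
    linarith

/-- The integrand of the index form of the conjugate equation at a trigonometric test function. -/
def indexIntegrand (l m : ℝ → ℝ) (ω c t : ℝ) : ℝ :=
  ω ^ 2 * l t * Real.cos (ω * (areaParam l t - c)) ^ 2 -
    m t * Real.sin (ω * (areaParam l t - c)) ^ 2

lemma indexIntegrand_cont (F : RadonFrame Ω A x y l m σ Θ) (ω c : ℝ) :
    Continuous (indexIntegrand l m ω c) := by
  have h1 := F.areaParam_cont
  have h2 := F.l_cont
  have h3 := F.m_cont
  unfold indexIntegrand
  fun_prop

lemma indexIntegrand_periodic (F : RadonFrame Ω A x y l m σ Θ) {ω : ℝ}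
    (hω : ω * areaParam l Real.pi = Real.pi) (c : ℝ) :
    Function.Periodic (indexIntegrand l m ω c) Real.pi := fun t => by
  have e : ω * (areaParam l (t + Real.pi) - c) = ω * (areaParam l t - c) + Real.pi := by
    rw [F.areaParam_add_pi]; linear_combination hω
  simp only [indexIntegrand, F.l_add_pi, F.m_add_pi, e, Real.cos_add_pi, Real.sin_add_pi, neg_sq]

lemma index_nonneg (F : RadonFrame Ω A x y l m σ Θ) {ω : ℝ}
    (hω : ω * areaParam l Real.pi = Real.pi) (a : ℝ) :
    0 ≤ ∫ t in (0 : ℝ)..Real.pi, indexIntegrand l m ω (areaParam l a) t ∧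
    (∫ t in (0 : ℝ)..Real.pi, indexIntegrand l m ω (areaParam l a) t = 0 →
      ∀ t ∈ Set.Ioo a (a + Real.pi),
        ω * Real.cos (ω * (areaParam l t - areaParam l a)) * cross (x a) (x t) =
          Real.sin (ω * (areaParam l t - areaParam l a)) * cross (x a) (y t)) := by
  set c := areaParam l a with hc
  set G := indexIntegrand l m ω c with hG
  have hGc : Continuous G := F.indexIntegrand_cont ω c
  have hJ : ∫ t in (0 : ℝ)..Real.pi, G t = ∫ t in a..(a + Real.pi), G t := by
    have := (F.indexIntegrand_periodic hω c).intervalIntegral_add_eq 0 a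
    rwa [zero_add] at this
  rw [hJ]
  have hA := F.A_pos
  have hpi := Real.pi_pos
  set u : ℝ → ℝ := fun t => cross (x a) (x t) with hu
  set z : ℝ → ℝ := fun t => cross (x a) (y t) with hz
  set f : ℝ → ℝ := fun t => Real.sin (ω * (areaParam l t - c)) with hf
  set g : ℝ → ℝ := fun t => Real.cos (ω * (areaParam l t - c)) with hg
  have hu' : ∀ t, HasDerivAt u (l t * z t) t := fun t =>
    (HasDerivAt.const_cross (x a) (F.hasDerivAt_x t)).congr_deriv (cross_smul_right _ _ _)
  have hz' : ∀ t, HasDerivAt z (-m t * u t) t := fun t =>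
    (HasDerivAt.const_cross (x a) (F.hasDerivAt_y t)).congr_deriv (cross_smul_right _ _ _)
  have hf' : ∀ t, HasDerivAt f (g t * (ω * l t)) t := fun t =>
    (((F.hasDerivAt_areaParam t).sub_const c).const_mul ω).sin
  have hupos : ∀ t ∈ Set.Ioo a (a + Real.pi), 0 < u t := by
    intro t ht
    obtain ⟨ρ, hρ, e⟩ := F.polar_x a
    obtain ⟨ρ', hρ', e'⟩ := F.polar_x t
    simp only [hu, e, e', cross_smul_left, cross_smul_right, cross_dir]
    have := Real.sin_pos_of_pos_of_lt_pi (x := t - a) (by linarith [ht.1]) (by linarith [ht.2])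
    positivity
  set K : ℝ → ℝ := fun t => (∫ s in a..t, G s) - f t ^ 2 * z t / u t with hK
  have hK' : ∀ t ∈ Set.Ioo a (a + Real.pi),
      HasDerivAt K (l t * (ω * g t - f t * z t / u t) ^ 2) t := by
    intro t ht
    have hu0 := (hupos t ht).ne'
    have h1 := (hGc.integral_hasStrictDerivAt a t).hasDerivAt
    have h2 := (((hf' t).pow 2).mul (hz' t)).div (hu' t) hu0
    refine (h1.sub h2).congr_deriv ?_
    simp only [hG, indexIntegrand, Pi.mul_apply, Pi.pow_apply]
    change ω ^ 2 * l t * g t ^ 2 - m t * f t ^ 2 - _ = _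
    field_simp
    push_cast
    ring
  have hmono : MonotoneOn K (Set.Ioo a (a + Real.pi)) := by
    refine monotoneOn_of_deriv_nonneg (convex_Ioo _ _)
      (fun t ht => (hK' t ht).continuousAt.continuousWithinAt)
      (fun t ht => ?_) (fun t ht => ?_)
    · rw [interior_Ioo] at ht
      exact (hK' t ht).differentiableAt.differentiableWithinAt
    · rw [interior_Ioo] at ht
      rw [(hK' t ht).deriv]
      exact mul_nonneg (F.l_pos t).le (sq_nonneg _)
  have hcontI : Continuous fun t => ∫ s in a..t, G s :=
    continuous_iff_continuousAt.2 fun t => (hGc.integral_hasStrictDerivAt a t).hasDerivAt.continuousAt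
  have hlim : ∀ p, f p = 0 → u p = 0 → z p ≠ 0 →
      Tendsto K (𝓝[≠] p) (𝓝 (∫ s in a..p, G s)) := by
    intro p hfp hup hzp
    have h1 := tendsto_sq_div_of_hasDerivAt (hf' p) (hu' p) hfp hup
      (mul_ne_zero (F.l_pos p).ne' hzp)
    have h2 := h1.mul ((hz' p).continuousAt.tendsto.mono_left nhdsWithin_le_nhds)
    have h3 := (hcontI.continuousAt (x := p)).tendsto.mono_left
      (nhdsWithin_le_nhds (s := ({p}ᶜ : Set ℝ)))
    have h4 := h3.sub h2
    rw [zero_mul, sub_zero] at h4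
    refine h4.congr fun t => ?_
    simp only [hK]
    ring
  have l1 : Tendsto K (𝓝[>] a) (𝓝 0) := by
    have := (hlim a (by simp [hf, hc]) (by simp [hu])
      (by simp only [hz, F.cross_xy]; exact hA.ne')).mono_left
      (nhdsWithin_mono a (show Set.Ioi a ⊆ {a}ᶜ from fun t ht => ne_of_gt ht))
    simpa using this
  have l2 : Tendsto K (𝓝[<] (a + Real.pi)) (𝓝 (∫ s in a..(a + Real.pi), G s)) := by
    refine (hlim (a + Real.pi) ?_ ?_ ?_).mono_left
      (nhdsWithin_mono _ (show Set.Iio (a + Real.pi) ⊆ {a + Real.pi}ᶜ from fun t ht => ne_of_lt ht))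
    · simp only [hf, F.areaParam_add_pi, hc, add_sub_cancel_left, hω, Real.sin_pi]
    · simp only [hu, F.x_add_pi, cross_neg_right, cross_self, neg_zero]
    · simp only [hz, F.y_add_pi, cross_neg_right, F.cross_xy]
      exact neg_ne_zero.2 hA.ne'
  have hlow : ∀ t ∈ Set.Ioo a (a + Real.pi), 0 ≤ K t := by
    intro t ht
    refine le_of_tendsto l1 ?_
    filter_upwards [self_mem_nhdsWithin, (eventually_lt_nhds ht.1).filter_mono nhdsWithin_le_nhds]
      with s hs hst
    exact hmono ⟨hs, hst.trans ht.2⟩ ht hst.le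
  have hupp : ∀ t ∈ Set.Ioo a (a + Real.pi), K t ≤ ∫ s in a..(a + Real.pi), G s := by
    intro t ht
    refine ge_of_tendsto l2 ?_
    filter_upwards [self_mem_nhdsWithin, (eventually_gt_nhds ht.2).filter_mono nhdsWithin_le_nhds]
      with s hs hst
    exact hmono ht ⟨ht.1.trans hst, hs⟩ hst.le
  have hmid : a + Real.pi / 2 ∈ Set.Ioo a (a + Real.pi) := ⟨by linarith, by linarith⟩
  refine ⟨(hlow _ hmid).trans (hupp _ hmid), fun h0 t ht => ?_⟩
  have hKz : K =ᶠ[𝓝 t] fun _ => 0 := by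
    filter_upwards [Ioo_mem_nhds ht.1 ht.2] with s hs
    exact le_antisymm (h0 ▸ hupp s hs) (hlow s hs)
  have h1 := ((hK' t ht).congr_of_eventuallyEq hKz.symm).unique (hasDerivAt_const t 0)
  have h2 : ω * g t - f t * z t / u t = 0 :=
    pow_eq_zero_iff two_ne_zero |>.1 ((mul_eq_zero.1 h1).resolve_left (F.l_pos t).ne')
  have hu0 := (hupos t ht).ne'
  change ω * g t * u t = f t * z t
  field_simp at h2
  linarith

lemma index_add_index (F : RadonFrame Ω A x y l m σ Θ) {ω : ℝ}
    (hω : ω * areaParam l Real.pi = Real.pi) (a : ℝ) : ∃ b,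
    (∫ t in (0 : ℝ)..Real.pi, indexIntegrand l m ω (areaParam l a) t) +
      (∫ t in (0 : ℝ)..Real.pi, indexIntegrand l m ω (areaParam l b) t) =
      (ω ^ 2 - 1) * areaParam l Real.pi := by
  obtain ⟨b, hb⟩ := F.areaParam_surjective (areaParam l a + areaParam l Real.pi / 2)
  refine ⟨b, ?_⟩
  rw [← intervalIntegral.integral_add ((F.indexIntegrand_cont _ _).intervalIntegrable _ _)
    ((F.indexIntegrand_cont _ _).intervalIntegrable _ _)]
  have e : ∀ t, indexIntegrand l m ω (areaParam l a) t + indexIntegrand l m ω (areaParam l b) t =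
      ω ^ 2 * l t - m t := by
    intro t
    have e1 : ω * (areaParam l t - areaParam l b) =
        ω * (areaParam l t - areaParam l a) - Real.pi / 2 := by
      rw [hb]; linear_combination (-1 / 2) * hω
    simp only [indexIntegrand, e1, Real.cos_sub_pi_div_two, Real.sin_sub_pi_div_two, neg_sq]
    linear_combination (ω ^ 2 * l t - m t) * Real.sin_sq_add_cos_sq (ω * (areaParam l t - areaParam l a))
  simp_rw [e]
  rw [intervalIntegral.integral_sub
    (Continuous.intervalIntegrable (u := fun t => ω ^ 2 * l t)
      (continuous_const.mul F.l_cont) _ _) (F.m_cont.intervalIntegrable _ _),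
    intervalIntegral.integral_const_mul, F.integral_m]
  change ω ^ 2 * areaParam l Real.pi - _ = _
  ring

theorem areaParam_pi_le (F : RadonFrame Ω A x y l m σ Θ) : areaParam l Real.pi ≤ Real.pi := by
  have hH := F.areaParam_pi_pos
  have hpi := Real.pi_pos
  set H := areaParam l Real.pi
  have hω : Real.pi / H * H = Real.pi := div_mul_cancel₀ _ hH.ne'
  obtain ⟨b, hb⟩ := F.index_add_index hω 0
  have h1 := (F.index_nonneg hω 0).1
  have h2 := (F.index_nonneg hω b).1
  have h3 : 0 ≤ (Real.pi / H) ^ 2 - 1 := by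
    by_contra hneg
    push Not at hneg
    have := mul_neg_of_neg_of_pos hneg hH
    linarith
  by_contra hlt
  push Not at hlt
  have h4 : Real.pi / H < 1 := (div_lt_one hH).2 hlt
  have h5 : 0 < Real.pi / H := by positivity
  nlinarith

lemma l_eq_m (F : RadonFrame Ω A x y l m σ Θ) (hH : areaParam l Real.pi = Real.pi) (t : ℝ) :
    m t = l t := by
  have hpi := Real.pi_pos
  have hω : 1 * areaParam l Real.pi = Real.pi := by rw [hH, one_mul]
  set a := t - Real.pi / 2 with ha
  obtain ⟨b, hb⟩ := F.index_add_index hω a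
  have h1 := F.index_nonneg hω a
  have h2 := (F.index_nonneg hω b).1
  have h0 : ∫ t in (0 : ℝ)..Real.pi, indexIntegrand l m 1 (areaParam l a) t = 0 := by
    rw [one_pow, sub_self, zero_mul] at hb
    linarith [h1.1]
  have key := h1.2 h0
  simp only [one_mul] at key
  set c := areaParam l a with hc
  have ht : t ∈ Set.Ioo a (a + Real.pi) := ⟨by linarith, by linarith⟩
  have hd := (F.hasDerivAt_areaParam t).sub_const c
  have d1 := (hd.cos).mul (HasDerivAt.const_cross (x a) (F.hasDerivAt_x t))
  have d2 := (hd.sin).mul (HasDerivAt.const_cross (x a) (F.hasDerivAt_y t))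
  have hz : (fun s => Real.cos (areaParam l s - c) * cross (x a) (x s) -
      Real.sin (areaParam l s - c) * cross (x a) (y s)) =ᶠ[𝓝 t] fun _ => 0 := by
    filter_upwards [Ioo_mem_nhds ht.1 ht.2] with s hs
    rw [key s hs, sub_self]
  have h3 := ((d1.sub d2).congr_of_eventuallyEq hz.symm).unique (hasDerivAt_const t 0)
  simp only [cross_smul_right] at h3
  have hs : 0 < Real.sin (areaParam l t - c) := by
    have m1 := F.areaParam_mono ht.1
    have m2 := F.areaParam_mono ht.2
    rw [F.areaParam_add_pi, hH] at m2
    exact Real.sin_pos_of_pos_of_lt_pi (by linarith) (by linarith)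
  have hu : 0 < cross (x a) (x t) := by
    obtain ⟨ρ, hρ, e⟩ := F.polar_x a
    obtain ⟨ρ', hρ', e'⟩ := F.polar_x t
    simp only [e, e', cross_smul_left, cross_smul_right, cross_dir]
    have := Real.sin_pos_of_pos_of_lt_pi (x := t - a) (by linarith [ht.1]) (by linarith [ht.2])
    positivity
  have h4 : (m t - l t) * (Real.sin (areaParam l t - c) * cross (x a) (x t)) = 0 := by
    linarith
  have := (mul_eq_zero.1 h4).resolve_right (mul_pos hs hu).ne'
  linarith

lemma x_eq_of_areaParam_pi (F : RadonFrame Ω A x y l m σ Θ)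
    (hH : areaParam l Real.pi = Real.pi) (t : ℝ) :
    x t = Real.cos (areaParam l t) • x 0 + Real.sin (areaParam l t) • y 0 := by
  have hml := F.l_eq_m hH
  set τ := areaParam l with hτ
  have hP : ∀ s, HasDerivAt (fun s => Real.cos (τ s) • x s - Real.sin (τ s) • y s) 0 s := by
    intro s
    have hd := F.hasDerivAt_areaParam s
    refine ((hd.cos.smul (F.hasDerivAt_x s)).sub (hd.sin.smul (F.hasDerivAt_y s))).congr_deriv ?_
    rw [hml]; module
  have hQ : ∀ s, HasDerivAt (fun s => Real.sin (τ s) • x s + Real.cos (τ s) • y s) 0 s := by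
    intro s
    have hd := F.hasDerivAt_areaParam s
    refine ((hd.sin.smul (F.hasDerivAt_x s)).add (hd.cos.smul (F.hasDerivAt_y s))).congr_deriv ?_
    rw [hml]; module
  have eP := is_const_of_deriv_eq_zero (fun s => (hP s).differentiableAt) (fun s => (hP s).deriv) t 0
  have eQ := is_const_of_deriv_eq_zero (fun s => (hQ s).differentiableAt) (fun s => (hQ s).deriv) t 0
  have h0 : τ 0 = 0 := areaParam_zero l
  simp only [h0, Real.cos_zero, Real.sin_zero, one_smul, zero_smul, sub_zero, zero_add] at eP eQ
  rw [← eP, ← eQ]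
  have e : x t = (Real.sin (τ t) ^ 2 + Real.cos (τ t) ^ 2) • x t := by
    rw [Real.sin_sq_add_cos_sq, one_smul]
  conv_lhs => rw [e]
  module

theorem area_le (F : RadonFrame Ω A x y l m σ Θ) : volume.real Ω ≤ A * Real.pi := by
  rw [F.area]
  exact mul_le_mul_of_nonneg_left F.areaParam_pi_le F.A_pos.le

theorem isEllipse_of_area_eq (F : RadonFrame Ω A x y l m σ Θ) (h : IsTable Ω)
    (harea : volume.real Ω = A * Real.pi) : IsEllipse Ω := by
  have hA := F.A_pos
  have hH : areaParam l Real.pi = Real.pi := by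
    rw [F.area] at harea
    exact mul_left_cancel₀ hA.ne' harea
  have hx := F.x_eq_of_areaParam_pi hH
  set L : Plane →ₗ[ℝ] Plane :=
    { toFun := fun p => p 0 • x 0 + p 1 • y 0
      map_add' := fun p q => by simp only [PiLp.add_apply]; module
      map_smul' := fun c p => by simp only [PiLp.smul_apply, smul_eq_mul, RingHom.id_apply]; module }
    with hL
  have hLapp : ∀ p, L p = p 0 • x 0 + p 1 • y 0 := fun _ => rfl
  have hinj : Function.Injective L := by
    rw [injective_iff_map_eq_zero]
    intro p hp
    rw [hLapp] at hp
    have e0 := congrArg (fun q => cross q (y 0)) hp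
    have e1 := congrArg (fun q => cross (x 0) q) hp
    simp only [cross_add_left, cross_add_right, cross_smul_left, cross_smul_right, cross_self,
      F.cross_xy, cross_zero_left, cross_zero_right, mul_zero, add_zero, zero_add] at e0 e1
    exact plane_ext ((mul_eq_zero.1 e0).resolve_right hA.ne')
      ((mul_eq_zero.1 e1).resolve_right hA.ne')
  have hbij : Function.Bijective L := ⟨hinj, LinearMap.injective_iff_surjective.1 hinj⟩
  have hLdir : ∀ t, L (dir (areaParam l t)) = x t := fun t => by
    rw [hLapp, hx t]; simp [dir]
  refine ⟨(LinearEquiv.ofBijective L hbij).toAffineEquiv, ?_⟩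
  ext q
  constructor
  · intro hq
    obtain ⟨s, hs, t, rfl⟩ := F.exists_smul q hq
    refine ⟨s • dir (areaParam l t), ?_, ?_⟩
    · rw [unitDisk, mem_closedBall_zero_iff, norm_smul, norm_dir, mul_one, Real.norm_eq_abs,
        abs_of_nonneg hs.1]
      exact hs.2
    · change L (s • dir (areaParam l t)) = s • x t
      rw [map_smul, hLdir]
  · rintro ⟨p, hp, rfl⟩
    rw [unitDisk, mem_closedBall_zero_iff] at hp
    obtain ⟨φ, hφ⟩ := exists_eq_norm_smul_dir p
    obtain ⟨t, rfl⟩ := F.areaParam_surjective φ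
    change L p ∈ Ω
    rw [hφ, map_smul, hLdir]
    exact h.convex.smul_mem_of_zero_mem (interior_subset h.zero_mem) (F.x_mem t)
      ⟨norm_nonneg _, hp⟩

end RadonFrame

/-! ### Ellipses -/

lemma abs_cross_le (p q : Plane) : |cross p q| ≤ ‖p‖ * ‖q‖ := by
  obtain ⟨a, ha⟩ := exists_eq_norm_smul_dir p
  obtain ⟨b, hb⟩ := exists_eq_norm_smul_dir q
  have e : cross p q = ‖p‖ * (‖q‖ * Real.sin (b - a)) := by
    conv_lhs => rw [ha, hb]
    rw [cross_smul_left, cross_smul_right, cross_dir]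
  rw [e, abs_mul, abs_mul, abs_norm, abs_norm]
  have := Real.abs_sin_le_one (b - a)
  have h1 : ‖q‖ * |Real.sin (b - a)| ≤ ‖q‖ := mul_le_of_le_one_right (norm_nonneg _) this
  exact mul_le_mul_of_nonneg_left h1 (norm_nonneg _)

lemma cross_map (L : Plane →ₗ[ℝ] Plane) (p q : Plane) :
    cross (L p) (L q) = LinearMap.det L * cross p q := by
  have hp : ∀ p : Plane, L p = p 0 • L (EuclideanSpace.single 0 1) +
      p 1 • L (EuclideanSpace.single 1 1) := by
    intro p
    rw [← map_smul, ← map_smul, ← map_add]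
    congr 1
    apply plane_ext <;> simp
  have hdet : LinearMap.det L = cross (L (EuclideanSpace.single 0 1))
      (L (EuclideanSpace.single 1 1)) := by
    rw [← LinearMap.det_toMatrix (EuclideanSpace.basisFun (Fin 2) ℝ).toBasis, Matrix.det_fin_two]
    simp [LinearMap.toMatrix_apply, cross]
    ring
  rw [hdet, hp p, hp q]
  simp only [cross_add_left, cross_add_right, cross_smul_left, cross_smul_right, cross_self,
    cross_swap (L (EuclideanSpace.single 1 1)) (L (EuclideanSpace.single 0 1))]
  simp only [cross]
  ring

lemma volume_real_unitDisk : volume.real unitDisk = Real.pi := by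
  rw [unitDisk, Measure.real, EuclideanSpace.volume_closedBall_fin_two]
  simp [ENNReal.toReal_ofReal Real.pi_pos.le]

namespace RadonFrame

variable {Ω : Set Plane} {A : ℝ} {x y : ℝ → Plane} {l m σ Θ : ℝ → ℝ}

theorem area_eq_of_isEllipse (F : RadonFrame Ω A x y l m σ Θ) (hE : IsEllipse Ω) :
    volume.real Ω = A * Real.pi := by
  obtain ⟨T, rfl⟩ := hE
  set L : Plane →ₗ[ℝ] Plane := (T.linear : Plane →ₗ[ℝ] Plane) with hL
  have hT : ∀ p, T p = L p + T 0 := fun p => by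
    have := T.map_vadd 0 p
    rw [vadd_eq_add, add_zero] at this
    exact this
  have hvol : volume.real (T '' unitDisk) = |LinearMap.det L| * Real.pi := by
    have e : T '' unitDisk = (fun q => q + T 0) '' (L '' unitDisk) := by
      rw [Set.image_image]
      exact Set.image_congr fun p _ => hT p
    rw [e, Set.image_add_right, Measure.real, measure_preimage_add_right,
      Measure.addHaar_image_linearMap, ENNReal.toReal_mul,
      ENNReal.toReal_ofReal (abs_nonneg _)]
    congr 1
    exact volume_real_unitDisk
  have hhalf : ∀ q, q ∈ T '' unitDisk → -q ∈ T '' unitDisk → ∃ p : Plane, ‖p‖ ≤ 1 ∧ q = L p := by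
    rintro q ⟨p, hp, hpq⟩ ⟨p', hp', hpq'⟩
    rw [unitDisk, mem_closedBall_zero_iff] at hp hp'
    refine ⟨(1 / 2 : ℝ) • (p - p'), ?_, ?_⟩
    · rw [norm_smul]
      have := norm_sub_le p p'
      norm_num
      linarith
    · rw [map_smul, map_sub]
      have e1 : L p = q - T 0 := by rw [← hpq, hT p]; simp
      have e2 : L p' = -q - T 0 := by rw [← hpq', hT p']; simp
      rw [e1, e2]; module
  obtain ⟨p, hp, ex⟩ := hhalf (x 0) (F.x_mem 0) (by rw [← F.x_add_pi]; exact F.x_mem _)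
  obtain ⟨q, hq, ey⟩ := hhalf (y 0) (by rw [← F.x_σ]; exact F.x_mem _)
    (by rw [← F.x_σ, ← F.x_add_pi]; exact F.x_mem _)
  have hA : A ≤ |LinearMap.det L| := by
    rw [← F.cross_xy 0, ex, ey, cross_map]
    refine (le_abs_self _).trans ?_
    rw [abs_mul]
    refine mul_le_of_le_one_right (abs_nonneg _) ((abs_cross_le p q).trans ?_)
    exact mul_le_one₀ hp (norm_nonneg _) hq
  refine le_antisymm F.area_le ?_
  rw [hvol]
  exact mul_le_mul_of_nonneg_right hA Real.pi_pos.le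

end RadonFrame

/-! ### The unit disk -/

lemma frontier_unitDisk : frontier unitDisk = Metric.sphere (0 : Plane) 1 :=
  frontier_closedBall 0 one_ne_zero

lemma isTable_unitDisk : IsTable unitDisk where
  isCompact := isCompact_closedBall 0 1
  strictConvex := strictConvex_closedBall ℝ 0 1
  zero_mem := by
    rw [unitDisk, interior_closedBall _ one_ne_zero]
    exact Metric.mem_ball_self one_pos
  boundary := by
    have hpi := Real.pi_pos
    have hd : ∀ t : ℝ, HasDerivAt (fun t => dir (2 * Real.pi * t))
        ((2 * Real.pi) • dir (2 * Real.pi * t + Real.pi / 2)) t := fun t => by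
      have h1 : HasDerivAt (fun t : ℝ => 2 * Real.pi * t) (2 * Real.pi) t := by
        simpa using (hasDerivAt_id t).const_mul (2 * Real.pi)
      exact (hasDerivAt_dir (2 * Real.pi * t)).scomp t h1
    refine ⟨fun t => dir (2 * Real.pi * t), ?_, ?_, ?_, ?_, ?_⟩
    · exact contDiff_dir.comp (contDiff_const.mul contDiff_id)
    · intro t
      simp only [mul_add, mul_one, dir_add_two_pi]
    · intro s hs t ht hst
      have h1 : Real.sin (2 * Real.pi * t - 2 * Real.pi * s) = 0 := by
        rw [← cross_dir]
        simp only at hst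
        rw [hst, cross_self]
      have h2 : Real.cos (2 * Real.pi * t - 2 * Real.pi * s) = 1 := by
        have e0 := congrArg (fun p : Plane => p 0) hst
        have e1 := congrArg (fun p : Plane => p 1) hst
        simp only [dir] at e0 e1
        simp at e0 e1
        rw [Real.cos_sub, e0, e1, ← sq, ← sq, Real.cos_sq_add_sin_sq]
      obtain ⟨n, hn⟩ := (Real.cos_eq_one_iff _).1 h2
      have h3 : (n : ℝ) = t - s := by
        have : (n : ℝ) * (2 * Real.pi) = (t - s) * (2 * Real.pi) := by linarith
        exact mul_right_cancel₀ (by positivity) this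
      have n1 : (-1 : ℝ) < n := by rw [h3]; linarith [hs.2, ht.1]
      have n2 : (n : ℝ) < 1 := by rw [h3]; linarith [hs.1, ht.2]
      have n3 : n = 0 := by
        have k1 : -1 < n := by exact_mod_cast n1
        have k2 : n < 1 := by exact_mod_cast n2
        omega
      rw [n3, Int.cast_zero] at h3
      linarith
    · intro t
      rw [(hd t).deriv]
      exact smul_ne_zero (by positivity) (dir_ne_zero _)
    · rw [frontier_unitDisk]
      ext p
      constructor
      · rintro ⟨t, rfl⟩
        simp [norm_dir]
      · intro hp
        rw [mem_sphere_zero_iff_norm] at hp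
        obtain ⟨θ, hθ⟩ := exists_eq_norm_smul_dir p
        rw [hp, one_smul] at hθ
        refine ⟨θ / (2 * Real.pi), ?_⟩
        simp only
        rw [mul_div_cancel₀ _ (by positivity), hθ]

lemma isRadonCurve_unitDisk : IsRadonCurve (frontier unitDisk) := by
  have hsph : ∀ {p}, p ∈ frontier unitDisk → ‖p‖ = 1 := fun {p} hp => by
    rwa [frontier_unitDisk, mem_sphere_zero_iff_norm] at hp
  have hsup : ∀ θ, Supports unitDisk (dir θ) (dir (θ + Real.pi / 2)) := fun θ => by
    refine ⟨by rw [cross_dir]; simp, fun q hq => ?_⟩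
    rw [unitDisk, mem_closedBall_zero_iff] at hq
    have := (le_abs_self _).trans (abs_cross_le q (dir (θ + Real.pi / 2)))
    rw [norm_dir, mul_one] at this
    exact this.trans hq
  refine ⟨fun p hp => ?_, fun p hp q hq hpq => ?_⟩
  · rw [frontier_unitDisk, mem_sphere_zero_iff_norm] at hp ⊢
    rwa [norm_neg]
  · obtain ⟨a, ha⟩ := exists_eq_norm_smul_dir p
    obtain ⟨b, hb⟩ := exists_eq_norm_smul_dir q
    rw [hsph hp, one_smul] at ha
    rw [hsph hq, one_smul] at hb
    subst ha hb
    have h1 := ((isTable_unitDisk.isTangentVector_iff hp (hsup a) _).1 hpq).2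
    refine (isTable_unitDisk.isTangentVector_iff hq (hsup b) _).2 ⟨dir_ne_zero a, ?_⟩
    rw [cross_dir] at h1 ⊢
    have e1 : a + Real.pi / 2 - b = Real.pi / 2 - (b - a) := by ring
    have e2 : b + Real.pi / 2 - a = (b - a) + Real.pi / 2 := by ring
    rw [e1, Real.sin_pi_div_two_sub] at h1
    rw [e2, Real.sin_add_pi_div_two, h1]

lemma RadonFrame.eq_one_of_unitDisk {A : ℝ} {x y : ℝ → Plane} {l m σ Θ : ℝ → ℝ}
    (F : RadonFrame unitDisk A x y l m σ Θ) : A = 1 := by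
  refine le_antisymm ?_ ?_
  · have hx : ∀ t, ‖x t‖ ≤ 1 := fun t => mem_closedBall_zero_iff.1 (F.x_mem t)
    have hy : ‖y 0‖ ≤ 1 := by rw [← F.x_σ]; exact hx _
    rw [← F.cross_xy 0]
    exact (le_abs_self _).trans ((abs_cross_le _ _).trans (mul_le_one₀ (hx 0) (norm_nonneg _) hy))
  · have := F.area_le
    rw [volume_real_unitDisk] at this
    by_contra hlt
    push Not at hlt
    nlinarith [Real.pi_pos]

end OuterBilliard

end

/-- For a strictly convex planar domain bounded by a `C²` Radon curve, Mather's beta function of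
the outer billiard at `1/4` is well defined and at least the value for the disk of equal area
(`volume.real Ω / π` times the value for the unit disk), with equality exactly for ellipses. -/
theorem mainTheorem7 (Ω : Set OuterBilliard.Plane) (hΩ : OuterBilliard.IsTable Ω)
    (hR : OuterBilliard.IsRadonCurve (frontier Ω)) :
    OuterBilliard.IsMinimalAverageAction (OuterBilliard.generatingFunction Ω) (1 / 4)
        (OuterBilliard.betaOut Ω (1 / 4)) ∧
      OuterBilliard.IsMinimalAverageAction
        (OuterBilliard.generatingFunction OuterBilliard.unitDisk) (1 / 4)
        (OuterBilliard.betaOut OuterBilliard.unitDisk (1 / 4)) ∧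
      OuterBilliard.betaOut Ω (1 / 4) ≥
        volume.real Ω / Real.pi * OuterBilliard.betaOut OuterBilliard.unitDisk (1 / 4) ∧
      (OuterBilliard.betaOut Ω (1 / 4) =
          volume.real Ω / Real.pi * OuterBilliard.betaOut OuterBilliard.unitDisk (1 / 4) ↔
        OuterBilliard.IsEllipse Ω) := by
  obtain ⟨A, x, y, l, m, σ, Θ, F⟩ := hR.exists_radonFrame hΩ
  obtain ⟨B, x', y', l', m', σ', Θ', G⟩ :=
    OuterBilliard.isRadonCurve_unitDisk.exists_radonFrame OuterBilliard.isTable_unitDisk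
  have hB : B = 1 := G.eq_one_of_unitDisk
  have hpi := Real.pi_pos
  rw [F.betaOut_eq hΩ, G.betaOut_eq OuterBilliard.isTable_unitDisk]
  refine ⟨F.isMinimalAverageAction hΩ,
    G.isMinimalAverageAction OuterBilliard.isTable_unitDisk, ?_, ?_⟩
  · rw [hB, mul_one, ge_iff_le, div_le_iff₀ hpi]
    exact F.area_le
  · rw [hB, mul_one, eq_div_iff hpi.ne']
    exact ⟨fun h => F.isEllipse_of_area_eq hΩ h.symm, fun h => (F.area_eq_of_isEllipse h).symm⟩
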